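/- Let $n\ge 1$. All cubes are cubes in $\mathbb R^n$ with sides parallel to the coordinate axes, and $2Q$ is the cube with the same centre as $Q$ and twice its sidelength. A weight is a non-negative locally integrable function $w$ on $\mathbb R^n$ that is not almost everywhere zero; write $w(E)=\int_E w$. Let $\mathsf M f(x)=\sup_{Q\ni x}\frac1{|Q|}\int_Q|f|$ be the uncentered Hardy–Littlewood maximal operator with respect to Lebesgue measure, the supremum being over all cubes $Q$ containing $x$. For a weight $w$ and $\alpha\in(0,1)$ put $$\mathsf C^w(\alpha)=\sup_{0<w(E)<\infty}\frac{w(\{x:\mathsf M\chi_E(x)>\alpha\})}{w(E)},\qquad [w]_{A_\infty}=\sup_Q\frac1{w(Q)}\int_Q\mathsf M(w\chi_Q),$$ where $E$ ranges over measurable sets, $Q$ ranges over cubes, and $0/0=0$. Write $w\in A_\infty$ if $[w]_{A_\infty}<\infty$. Let $\Delta_w\in[0,\infty]$ be the least constant with $w(2Q)\le\Delta_w w(Q)$ for all cubes $Q$. (i) There are constants $C_n,c_n>1$ depending only on $n$ such that every $w\in A_\infty$ satisfies $\Delta_w<\infty$ and $$\mathsf C^w(\alpha)-1\le C_n\Delta_w^2(1-\alpha)^{1/(c_n[w]_{A_\infty})}\quad\text{whenever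 } 1>\alpha>1-e^{-c_n[w]_{A_\infty}}.$$ If $n=1$, there are absolute constants $C,c>1$ such that every $w\in A_\infty$ satisfies $$\mathsf C^w(\alpha)-1\le C(1-\alpha)^{1/(c[w]_{A_\infty})}\quad\text{whenever } 1>\alpha>1-e^{-c[w]_{A_\infty}}.$$ (ii) Conversely, there is a constant $K_n>0$ depending only on $n$ such that, if a weight $w$ satisfies, for some constants $B,\beta\ge1$, $$\mathsf C^w(\alpha)-1\le B(1-\alpha)^{1/\beta}\quad\text{whenever } 1>\alpha>1-e^{-\beta},$$ then $w\in A_\infty$ and $[w]_{A_\infty}\le K_n\,\beta\,(1+\log B)$. (iii) For every weight $w$, one has $\lim_{\alpha\to1^-}\mathsf C^w(\alpha)=1$ if and only if $w\in A_\infty$. -/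

import Mathlib

open MeasureTheory Filter Topology
open scoped ENNReal

noncomputable section

/-- The cube in `ℝⁿ` with sides parallel to the coordinate axes, centre `z` and sidelength `r`. -/
def axisCube {n : ℕ} (z : Fin n → ℝ) (r : ℝ) : Set (Fin n → ℝ) :=
  {y | ∀ i, |y i - z i| ≤ r / 2}

theorem axisCube_eq_closedBall {n : ℕ} (z : Fin n → ℝ) {r : ℝ} (hr : 0 < r) :
    axisCube z r = Metric.closedBall z (r / 2) := by
  ext y
  rw [Metric.mem_closedBall, dist_pi_le_iff (by positivity)]
  rfl

/-- A weight: a non-negative locally integrable function on `ℝⁿ` that is not almost everywhere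
zero. -/
structure IsWeight {n : ℕ} (w : (Fin n → ℝ) → ℝ) : Prop where
  nonneg : ∀ x, 0 ≤ w x
  locallyIntegrable : LocallyIntegrable w volume
  not_ae_zero : ¬ w =ᵐ[volume] 0

/-- The measure `w(x) dx`. -/
def weightMeasure {n : ℕ} (w : (Fin n → ℝ) → ℝ) : Measure (Fin n → ℝ) :=
  volume.withDensity fun x => ENNReal.ofReal (w x)

/-- The uncentered Hardy-Littlewood maximal function of `f` with respect to Lebesgue measure:
`M f (x) = sup |Q|⁻¹ ∫_Q |f|`, the supremum being over all cubes `Q` that contain `x`. -/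
def maximalFn {n : ℕ} (f : (Fin n → ℝ) → ℝ) (x : Fin n → ℝ) : ℝ≥0∞ :=
  ⨆ (z : Fin n → ℝ) (r : ℝ) (_ : 0 < r) (_ : x ∈ axisCube z r),
    (∫⁻ y in axisCube z r, ‖f y‖ₑ) / volume (axisCube z r)

/-- The weighted sharp Tauberian constant
`C^w(α) = sup { w({M χ_E > α}) / w(E) : E measurable, 0 < w(E) < ∞ }`. -/
def tauberianConst {n : ℕ} (w : (Fin n → ℝ) → ℝ) (α : ℝ) : ℝ≥0∞ :=
  ⨆ (E : Set (Fin n → ℝ)) (_ : MeasurableSet E) (_ : 0 < weightMeasure w E)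
    (_ : weightMeasure w E < ∞),
    weightMeasure w {x | ENNReal.ofReal α < maximalFn (E.indicator fun _ => (1 : ℝ)) x} /
      weightMeasure w E

/-- The Fujii-Wilson constant `[w]_{A_∞} = sup_Q w(Q)⁻¹ ∫_Q M(w χ_Q)`
(cubes with `w(Q) = 0` contribute `0 / 0 = 0`). -/
def fujiiWilson {n : ℕ} (w : (Fin n → ℝ) → ℝ) : ℝ≥0∞ :=
  ⨆ (z : Fin n → ℝ) (r : ℝ) (_ : 0 < r),
    (∫⁻ x in axisCube z r, maximalFn ((axisCube z r).indicator w) x) /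
      weightMeasure w (axisCube z r)

/-- The Muckenhoupt class `A_∞`. -/
def MemAInfty {n : ℕ} (w : (Fin n → ℝ) → ℝ) : Prop :=
  IsWeight w ∧ fujiiWilson w < ∞

/-- The doubling constant of `w(x) dx`: the least `D` such that `w(2Q) ≤ D w(Q)` for every
cube `Q`; it is `∞` if `w(x) dx` is not doubling. -/
def doublingConst {n : ℕ} (w : (Fin n → ℝ) → ℝ) : ℝ≥0∞ :=
  sInf {D : ℝ≥0∞ | ∀ (z : Fin n → ℝ) (r : ℝ), 0 < r →
    weightMeasure w (axisCube z (2 * r)) ≤ D * weightMeasure w (axisCube z r)}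

end

/-! Everything passes through one quantitative `A_∞` condition, `IsHalving μ δ`, for the measure `μ
= w dx`. It lies between the Fujii–Wilson constant and the Tauberian constant, and each passage
loses only dimensional factors in `log (1/δ)`.

From `[w]_{A_∞}` to halving: by a Calderón–Zygmund decomposition, the mass where the density exceeds
`t` is at most `2^n t` times the volume of a superlevel set of the maximal function. Integrating
over heights bounds the mass at densities above `L` times the average by a multiple of `[w]_{A_∞} /
log L`, so `log (1/δ) ~ [w]_{A_∞}` suffices (`isHalving_of_fujiiWilson`). Iterating the
decomposition turns halving into power decay with exponent `θ = log 2 / log (2^n/δ) ~ 1/[w]_{A_∞}`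
(`IsHalving.rnDeriv_decay`), hence `μ F ≤ 3 l^(θ/2) μ Q` whenever `F ⊆ Q` and `|F| ≤ l |Q|`
(`IsHalving.measure_le`).

Direct estimate: a Solyanik estimate for Lebesgue measure (`volume_biUnion_diff_le`), obtained from
a Kneser inequality and a Vitali selection, is applied inside the fourfold dilates of disjoint cubes
and transferred to `μ` by the power bound. Returning from the dilates costs `Δ_w²`. On the line, a
subcover with overlap at most two replaces the selection and no doubling is needed.

Converse: if `C^w(α) ≤ 3/2` at a single `α`, testing on `E = Q \ F` gives halving with `δ = (1-α)/2`
(`isHalving_of_tauberian`). The decay and the weak type inequality then bound the Fujii–Wilson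
integral by a multiple of `1/θ` (`IsHalving.lintegral_cubeMax_le`). The limit characterization
combines the two directions. -/

section

open Metric Set

/-- The uncentered maximal function of a measure, over closed cubes. -/
noncomputable def cubeMax {n : ℕ} (ν : Measure (Fin n → ℝ)) (x : Fin n → ℝ) : ℝ≥0∞ :=
  ⨆ (z : Fin n → ℝ) (r : ℝ) (_ : 0 < r) (_ : x ∈ closedBall z r),
    ν (closedBall z r) / volume (closedBall z r)

/-! ### Maximal function of a measure over closed cubes. -/

section CubeMax

variable {n : ℕ}

theorem volume_cube_pos (z : Fin n → ℝ) {r : ℝ} (hr : 0 < r) :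
    0 < volume (closedBall z r) := measure_closedBall_pos _ _ hr

theorem volume_cube_ne_zero (z : Fin n → ℝ) {r : ℝ} (hr : 0 < r) :
    volume (closedBall z r) ≠ 0 := (volume_cube_pos z hr).ne'

theorem volume_cube_ne_top (z : Fin n → ℝ) (r : ℝ) :
    volume (closedBall z r) ≠ ∞ := measure_closedBall_lt_top.ne

theorem volume_cube_mul (z z' : Fin n → ℝ) {r c : ℝ} (hr : 0 ≤ r) (hc : 0 ≤ c) :
    volume (closedBall z (c * r)) = ENNReal.ofReal (c ^ n) * volume (closedBall z' r) := by
  rw [Real.volume_pi_closedBall _ (by positivity), Real.volume_pi_closedBall _ hr,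
    ← ENNReal.ofReal_mul (by positivity)]
  congr 1
  simp only [Fintype.card_fin]
  rw [← mul_pow]; ring

theorem lt_cubeMax_iff {ν : Measure (Fin n → ℝ)} {x : Fin n → ℝ} {t : ℝ≥0∞} :
    t < cubeMax ν x ↔ ∃ z r, 0 < r ∧ x ∈ closedBall z r ∧
      t * volume (closedBall z r) < ν (closedBall z r) := by
  unfold cubeMax
  simp only [lt_iSup_iff]
  constructor
  · rintro ⟨z, r, hr, hx, h⟩
    refine ⟨z, r, hr, hx, ?_⟩
    rwa [ENNReal.lt_div_iff_mul_lt (Or.inl (volume_cube_ne_zero z hr))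
      (Or.inl (volume_cube_ne_top z r))] at h
  · rintro ⟨z, r, hr, hx, h⟩
    refine ⟨z, r, hr, hx, ?_⟩
    rwa [ENNReal.lt_div_iff_mul_lt (Or.inl (volume_cube_ne_zero z hr))
      (Or.inl (volume_cube_ne_top z r))]

/-- Volume is continuous in the radius and the mass is monotone, so a strict inequality survives a
slight enlargement. A point on the boundary of a cube thus becomes interior, which makes the
superlevel sets of `cubeMax` open. -/
theorem exists_larger_cube {ν : Measure (Fin n → ℝ)} {z : Fin n → ℝ} {r : ℝ} {t : ℝ≥0∞}
    (hr : 0 < r) (ht : t ≠ ∞) (h : t * volume (closedBall z r) < ν (closedBall z r)) :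
    ∃ r', r < r' ∧ t * volume (closedBall z r') < ν (closedBall z r') := by
  have hc : ContinuousAt (fun s : ℝ => t * ENNReal.ofReal ((2 * s) ^ n)) r := by
    apply ContinuousAt.comp (f := fun s : ℝ => ENNReal.ofReal ((2 * s) ^ n)) (g := fun u => t * u)
    · exact (ENNReal.continuous_const_mul ht).continuousAt
    · exact (ENNReal.continuous_ofReal.comp (by fun_prop)).continuousAt
  have h1 : t * ENNReal.ofReal ((2 * r) ^ n) < ν (closedBall z r) := by
    rw [Real.volume_pi_closedBall _ hr.le] at h
    simpa using h
  have h2 : ∀ᶠ s in 𝓝[>] r, t * ENNReal.ofReal ((2 * s) ^ n) < ν (closedBall z r) :=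
    (hc.eventually (gt_mem_nhds h1)).filter_mono nhdsWithin_le_nhds
  obtain ⟨s, hs, hrs⟩ := (h2.and self_mem_nhdsWithin).exists
  have hrs : r < s := hrs
  refine ⟨s, hrs, ?_⟩
  rw [Real.volume_pi_closedBall _ (hr.trans hrs).le]
  simp only [Fintype.card_fin]
  exact hs.trans_le (measure_mono (closedBall_subset_closedBall hrs.le))

theorem lt_cubeMax_iff_ball {ν : Measure (Fin n → ℝ)} {x : Fin n → ℝ} {t : ℝ≥0∞} (ht : t ≠ ∞) :
    t < cubeMax ν x ↔ ∃ z r, 0 < r ∧ x ∈ ball z r ∧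
      t * volume (closedBall z r) < ν (closedBall z r) := by
  rw [lt_cubeMax_iff]
  constructor
  · rintro ⟨z, r, hr, hx, h⟩
    obtain ⟨r', hr', h'⟩ := exists_larger_cube hr ht h
    exact ⟨z, r', hr.trans hr', closedBall_subset_ball hr' hx, h'⟩
  · rintro ⟨z, r, hr, hx, h⟩
    exact ⟨z, r, hr, ball_subset_closedBall hx, h⟩

theorem isOpen_lt_cubeMax (ν : Measure (Fin n → ℝ)) (t : ℝ≥0∞) :
    IsOpen {x | t < cubeMax ν x} := by
  rcases eq_or_ne t ∞ with rfl | ht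
  · simp
  rw [isOpen_iff_mem_nhds]
  intro x hx
  obtain ⟨z, r, hr, hxz, h⟩ := (lt_cubeMax_iff_ball ht).1 hx
  refine mem_of_superset (isOpen_ball.mem_nhds hxz) fun y hy => ?_
  exact (lt_cubeMax_iff_ball ht).2 ⟨z, r, hr, hy, h⟩

theorem measurable_cubeMax (ν : Measure (Fin n → ℝ)) : Measurable (cubeMax ν) :=
  measurable_of_Ioi fun t => (isOpen_lt_cubeMax ν t).measurableSet

theorem le_cubeMax {ν : Measure (Fin n → ℝ)} {z x : Fin n → ℝ} {r : ℝ} (hr : 0 < r)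
    (hx : x ∈ closedBall z r) :
    ν (closedBall z r) / volume (closedBall z r) ≤ cubeMax ν x :=
  le_iSup₂_of_le z r (le_iSup₂_of_le hr hx le_rfl)

theorem maximalFn_indicator {w : (Fin n → ℝ) → ℝ} (hw : ∀ x, 0 ≤ w x) {S : Set (Fin n → ℝ)}
    (hS : MeasurableSet S) (x : Fin n → ℝ) :
    maximalFn (S.indicator w) x = cubeMax ((weightMeasure w).restrict S) x := by
  have key : ∀ z r, ∫⁻ y in closedBall z r, ‖S.indicator w y‖ₑ =
      (weightMeasure w).restrict S (closedBall z r) := by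
    intro z r
    rw [Measure.restrict_apply isClosed_closedBall.measurableSet, weightMeasure,
      withDensity_apply _ (isClosed_closedBall.measurableSet.inter hS),
      Set.inter_comm, ← Measure.restrict_restrict hS, ← lintegral_indicator hS]
    refine lintegral_congr fun y => ?_
    by_cases hy : y ∈ S
    · simp [hy, Real.enorm_of_nonneg (hw y)]
    · simp [hy]
  unfold maximalFn cubeMax
  apply le_antisymm
  · refine iSup_le fun z => iSup_le fun r => iSup_le fun hr => iSup_le fun hx => ?_
    rw [axisCube_eq_closedBall z hr] at hx ⊢
    rw [key]
    exact le_iSup₂_of_le z (r / 2) (le_iSup₂_of_le (half_pos hr) hx le_rfl)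
  · refine iSup_le fun z => iSup_le fun r => iSup_le fun hr => iSup_le fun hx => ?_
    have h2 : axisCube z (2 * r) = closedBall z r := by
      rw [axisCube_eq_closedBall z (by positivity)]; congr 1; ring
    refine le_iSup₂_of_le z (2 * r) (le_iSup₂_of_le (by positivity) (by rwa [h2]) ?_)
    rw [h2, key]

theorem weightMeasure_one : weightMeasure (fun _ : Fin n → ℝ => (1 : ℝ)) = volume := by
  simp [weightMeasure]

theorem maximalFn_indicator_one {S : Set (Fin n → ℝ)}
    (hS : MeasurableSet S) (x : Fin n → ℝ) :
    maximalFn (S.indicator fun _ => (1 : ℝ)) x = cubeMax (volume.restrict S) x := by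
  rw [maximalFn_indicator (fun _ => zero_le_one) hS, weightMeasure_one]

end CubeMax

/-! ### Dyadic subcubes and the Calderón–Zygmund decomposition. -/

section Dyadic

variable {n : ℕ}

/-- The index of the dyadic subcube of generation `m` of `closedBall z r` that contains `x`. -/
noncomputable def dyadicIndex (z : Fin n → ℝ) (r : ℝ) (m : ℕ) (x : Fin n → ℝ) : Fin n → ℤ :=
  fun i => ⌊(x i - z i + r) / (2 * r) * 2 ^ m⌋

/-- The closed dyadic subcube of generation `m` and index `k` of `closedBall z r` has this centre
and radius `r / 2 ^ m`. -/
noncomputable def dyadicCenter (z : Fin n → ℝ) (r : ℝ) (m : ℕ) (k : Fin n → ℤ) : Fin n → ℝ :=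
  fun i => z i - r + 2 * r * (k i + 1 / 2) / 2 ^ m

theorem mem_dyadic_iff {z : Fin n → ℝ} {r : ℝ} (hr : 0 < r) {m : ℕ} {k : Fin n → ℤ}
    {x : Fin n → ℝ} : x ∈ closedBall (dyadicCenter z r m k) (r / 2 ^ m) ↔
      ∀ i, (k i : ℝ) ≤ (x i - z i + r) / (2 * r) * 2 ^ m ∧
        (x i - z i + r) / (2 * r) * 2 ^ m ≤ k i + 1 := by
  rw [mem_closedBall, dist_pi_le_iff (by positivity)]
  refine forall_congr' fun i => ?_
  have h2 : (0 : ℝ) < 2 ^ m := by positivity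
  have e : x i - dyadicCenter z r m k i =
      2 * r / 2 ^ m * ((x i - z i + r) / (2 * r) * 2 ^ m - k i - 1 / 2) := by
    unfold dyadicCenter; field_simp; ring
  have e2 : r / 2 ^ m = 2 * r / 2 ^ m * (1 / 2) := by ring
  have h3 : 0 < 2 * r / 2 ^ m := by positivity
  rw [Real.dist_eq, e, abs_mul, abs_of_pos h3, e2, mul_le_mul_iff_right₀ h3, abs_le]
  constructor
  · rintro ⟨h, h'⟩; constructor <;> linarith
  · rintro ⟨h, h'⟩; constructor <;> linarith

theorem mem_dyadicIndex {z : Fin n → ℝ} {r : ℝ} (hr : 0 < r) (m : ℕ) (x : Fin n → ℝ) :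
    x ∈ closedBall (dyadicCenter z r m (dyadicIndex z r m x)) (r / 2 ^ m) :=
  (mem_dyadic_iff hr).2 fun _ => ⟨Int.floor_le _, (Int.lt_floor_add_one _).le⟩

theorem dyadicIndex_succ (z : Fin n → ℝ) (r : ℝ) (m : ℕ) (x : Fin n → ℝ) (i : Fin n) :
    2 * dyadicIndex z r m x i ≤ dyadicIndex z r (m + 1) x i ∧
      dyadicIndex z r (m + 1) x i ≤ 2 * dyadicIndex z r m x i + 1 := by
  unfold dyadicIndex
  have e : (x i - z i + r) / (2 * r) * 2 ^ (m + 1) = 2 * ((x i - z i + r) / (2 * r) * 2 ^ m) := by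
    ring
  rw [e]
  set v := (x i - z i + r) / (2 * r) * 2 ^ m
  have h1 := Int.floor_le v
  have h2 := Int.lt_floor_add_one v
  constructor
  · rw [Int.le_floor]; push_cast; linarith
  · rw [← Int.lt_add_one_iff, Int.floor_lt]; push_cast; linarith

theorem dyadicIndex_eq_of_succ {z : Fin n → ℝ} {r : ℝ} {m : ℕ} {x y : Fin n → ℝ}
    (h : dyadicIndex z r (m + 1) x = dyadicIndex z r (m + 1) y) :
    dyadicIndex z r m x = dyadicIndex z r m y := by
  funext i
  have h1 := dyadicIndex_succ z r m x i
  have h2 := dyadicIndex_succ z r m y i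
  rw [h] at h1
  omega

theorem dyadicIndex_eq_of_le {z : Fin n → ℝ} {r : ℝ} {m m' : ℕ} {x y : Fin n → ℝ} (hm : m ≤ m')
    (h : dyadicIndex z r m' x = dyadicIndex z r m' y) :
    dyadicIndex z r m x = dyadicIndex z r m y := by
  induction m', hm using Nat.le_induction with
  | base => exact h
  | succ k _ ih => exact ih (dyadicIndex_eq_of_succ h)

theorem dyadic_subset_succ {z : Fin n → ℝ} {r : ℝ} (hr : 0 < r) (m : ℕ) (x : Fin n → ℝ) :
    closedBall (dyadicCenter z r (m + 1) (dyadicIndex z r (m + 1) x)) (r / 2 ^ (m + 1)) ⊆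
      closedBall (dyadicCenter z r m (dyadicIndex z r m x)) (r / 2 ^ m) := by
  intro y hy
  rw [mem_dyadic_iff hr] at hy ⊢
  intro i
  obtain ⟨h1, h2⟩ := hy i
  obtain ⟨h3, h4⟩ := dyadicIndex_succ z r m x i
  have h3' : (2 * dyadicIndex z r m x i : ℝ) ≤ dyadicIndex z r (m + 1) x i := by exact_mod_cast h3
  have h4' : (dyadicIndex z r (m + 1) x i : ℝ) ≤ 2 * dyadicIndex z r m x i + 1 := by
    exact_mod_cast h4
  rw [pow_succ] at h1 h2
  constructor <;> linarith

theorem dyadicCenter_zero (z : Fin n → ℝ) (r : ℝ) : dyadicCenter z r 0 0 = z := by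
  funext i; simp [dyadicCenter]; ring

theorem dyadic_subset {z : Fin n → ℝ} {r : ℝ} (hr : 0 < r) (m : ℕ) {x : Fin n → ℝ}
    (hx : dyadicIndex z r 0 x = 0) :
    closedBall (dyadicCenter z r m (dyadicIndex z r m x)) (r / 2 ^ m) ⊆ closedBall z r := by
  induction m with
  | zero => rw [hx, dyadicCenter_zero]; simp
  | succ m ih => exact (dyadic_subset_succ hr m x).trans ih

/-- Closed dyadic cubes of one generation meet only in faces, and all faces lie in countably many
null hyperplanes. Off these, lying in a closed cube determines the index. -/
theorem ae_dyadicIndex_eq (z : Fin n → ℝ) {r : ℝ} (hr : 0 < r) : ∀ᵐ y : Fin n → ℝ, ∀ m k,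
    y ∈ closedBall (dyadicCenter z r m k) (r / 2 ^ m) → dyadicIndex z r m y = k := by
  have h : ∀ᵐ y : Fin n → ℝ, ∀ (m : ℕ) (i : Fin n) (j : ℤ),
      y i ≠ z i - r + 2 * r * j / 2 ^ m := by
    rw [ae_all_iff]; intro m
    rw [ae_all_iff]; intro i
    rw [ae_all_iff]; intro j
    rw [ae_iff]
    simp only [not_not]
    exact Measure.pi_hyperplane (fun _ : Fin n => (volume : Measure ℝ)) i _
  filter_upwards [h] with y hy m k hk
  rw [mem_dyadic_iff hr] at hk
  funext i
  obtain ⟨h1, h2⟩ := hk i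
  refine Int.floor_eq_iff.2 ⟨h1, lt_of_le_of_ne h2 fun h3 => hy m i (k i + 1) ?_⟩
  push_cast
  rw [← h3]
  field_simp
  ring

/-- The **Calderón–Zygmund decomposition** of a cube at height `t`. -/
theorem exists_calderonZygmund (μ : Measure (Fin n → ℝ)) [IsLocallyFiniteMeasure μ]
    (z : Fin n → ℝ) {r : ℝ} (hr : 0 < r) {t : ℝ≥0∞}
    (ht : μ (closedBall z r) ≤ t * volume (closedBall z r)) :
    ∃ (ι : Type) (_ : Countable ι) (c : ι → Fin n → ℝ) (ρ : ι → ℝ), (∀ i, 0 < ρ i) ∧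
      (∀ i, closedBall (c i) (ρ i) ⊆ closedBall z r) ∧
      (∀ i, t * volume (closedBall (c i) (ρ i)) < μ (closedBall (c i) (ρ i))) ∧
      (∀ i, μ (closedBall (c i) (ρ i)) ≤ 2 ^ n * t * volume (closedBall (c i) (ρ i))) ∧
      Pairwise (Function.onFun (AEDisjoint volume) fun i => closedBall (c i) (ρ i)) ∧
      ∀ᵐ x : Fin n → ℝ, x ∈ closedBall z r → x ∉ ⋃ i, closedBall (c i) (ρ i) →
        μ.rnDeriv volume x ≤ t := by
  classical
  set D : ℕ → (Fin n → ℤ) → Set (Fin n → ℝ) := fun m k =>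
    closedBall (dyadicCenter z r m k) (r / 2 ^ m) with hD
  set bad : ℕ → (Fin n → ℤ) → Prop := fun m k => t * volume (D m k) < μ (D m k) with hbad
  -- Selected cubes are the first bad ones on the descent through the cubes indexed by some point
  -- `x`; index `0` in generation `0` makes the descent start at the given cube.
  set S : ℕ × (Fin n → ℤ) → Prop := fun p => ∃ x, dyadicIndex z r 0 x = 0 ∧
    dyadicIndex z r p.1 x = p.2 ∧ bad p.1 p.2 ∧ ∀ j < p.1, ¬ bad j (dyadicIndex z r j x) with hS
  have hD0 : D 0 0 = closedBall z r := by simp [hD, dyadicCenter_zero]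
  refine ⟨{p // S p}, inferInstance, fun p => dyadicCenter z r p.1.1 p.1.2,
    fun p => r / 2 ^ p.1.1, fun p => by positivity, ?_, ?_, ?_, ?_, ?_⟩
  · rintro ⟨⟨m, k⟩, x, h0, h1, h2⟩
    dsimp only at h1 ⊢
    rw [← h1]
    exact dyadic_subset hr m h0
  · rintro ⟨⟨m, k⟩, x, h0, h1, h2, h3⟩
    exact h2
  · rintro ⟨⟨m, k⟩, x, h0, h1, h2, h3⟩
    dsimp only at h1 h2 h3 ⊢
    subst h1
    cases m with
    | zero =>
      rw [h0] at h2
      simp only [hbad, hD0] at h2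
      exact absurd h2 (not_lt.2 ht)
    | succ m =>
      -- The dyadic parent was not selected, so its average is at most `t`, and its volume is `2^n`
      -- times larger.
      have h4 := not_lt.1 (h3 m (Nat.lt_succ_self m))
      refine (measure_mono (dyadic_subset_succ hr m x)).trans (h4.trans (le_of_eq ?_))
      have e : r / 2 ^ m = 2 * (r / 2 ^ (m + 1)) := by rw [pow_succ]; field_simp
      simp only [hD]
      rw [e, volume_cube_mul _ (dyadicCenter z r (m + 1) (dyadicIndex z r (m + 1) x))
        (by positivity) zero_le_two, ENNReal.ofReal_pow zero_le_two, ENNReal.ofReal_ofNat]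
      ring
  · rintro ⟨⟨m, k⟩, x, h0, h1, h2, h3⟩ ⟨⟨m', k'⟩, x', h0', h1', h2', h3'⟩ hne
    dsimp only at h1 h2 h3 h1' h2' h3'
    refine measure_mono_null ?_ (ae_iff.1 (ae_dyadicIndex_eq z hr))
    rintro y ⟨hy, hy'⟩
    rw [mem_ofPred_eq]
    intro hgen
    have e1 := hgen m k hy
    have e2 := hgen m' k' hy'
    -- If two selected cubes share a generic point, the coarser one is an ancestor of the finer one
    -- and would have stopped the descent earlier.
    rcases lt_trichotomy m m' with hlt | heq | hlt
    · refine h3' m hlt ?_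
      rw [dyadicIndex_eq_of_le hlt.le (h1'.trans e2.symm), e1]
      exact h2
    · subst heq
      exact hne (by simp [← e1, ← e2])
    · refine h3 m' hlt ?_
      rw [dyadicIndex_eq_of_le hlt.le (h1.trans e1.symm), e2]
      exact h2'
  · filter_upwards [ae_dyadicIndex_eq z hr,
      (IsUnifLocDoublingMeasure.vitaliFamily (volume : Measure (Fin n → ℝ)) 1).ae_tendsto_rnDeriv μ]
      with x hgen hlim hx hxU
    have h0 : dyadicIndex z r 0 x = 0 := hgen 0 0 (by change x ∈ D 0 0; rwa [hD0])
    have hgood : ∀ m, ¬ bad m (dyadicIndex z r m x) := by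
      by_contra! hex
      refine hxU (mem_iUnion.2 ⟨⟨⟨Nat.find hex, dyadicIndex z r (Nat.find hex) x⟩, x, h0, rfl,
        Nat.find_spec hex, fun j hj => Nat.find_min hex hj⟩, mem_dyadicIndex hr _ x⟩)
    have hδ : Tendsto (fun m : ℕ => r / 2 ^ m) atTop (𝓝[>] 0) := by
      refine tendsto_nhdsWithin_iff.2 ⟨?_, Eventually.of_forall fun m => ?_⟩
      · have := (tendsto_pow_atTop_nhds_zero_of_lt_one (r := (1 / 2 : ℝ)) (by norm_num)
          (by norm_num)).const_mul r
        simpa [div_eq_mul_inv] using this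
      · simp only [mem_Ioi]; positivity
    -- The cubes need not be centred at `x`; they contain it, which suffices for differentiation
    -- along the Vitali family.
    have hlim' := hlim.comp (IsUnifLocDoublingMeasure.tendsto_closedBall_filterAt volume
      (fun m => dyadicCenter z r m (dyadicIndex z r m x)) _ hδ
      (Eventually.of_forall fun m => by rw [one_mul]; exact mem_dyadicIndex hr m x))
    refine le_of_tendsto hlim' (Eventually.of_forall fun m => ?_)
    exact ENNReal.div_le_of_le_mul (not_lt.1 (hgood m))

end Dyadic

/-! ### The halving condition and the power decay it implies. -/

/-- Every measurable part of a cube that has at most the fraction `δ` of its volume carries at most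
half of its `μ`-mass. -/
def IsHalving {n : ℕ} (μ : Measure (Fin n → ℝ)) (δ : ℝ) : Prop :=
  ∀ (z : Fin n → ℝ) (r : ℝ), 0 < r → ∀ F ⊆ closedBall z r, MeasurableSet F →
    volume F ≤ ENNReal.ofReal δ * volume (closedBall z r) → μ F ≤ 2⁻¹ * μ (closedBall z r)

section Decay

variable {n : ℕ}

theorem measure_inter_rnDeriv_le (μ : Measure (Fin n → ℝ)) [IsLocallyFiniteMeasure μ]
    (hμ : μ ≪ volume) {F : Set (Fin n → ℝ)} (hF : MeasurableSet F) (t : ℝ≥0∞) :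
    μ (F ∩ {x | μ.rnDeriv volume x ≤ t}) ≤ t * volume F := by
  have hm : MeasurableSet (F ∩ {x | μ.rnDeriv volume x ≤ t}) :=
    hF.inter (measurableSet_le (Measure.measurable_rnDeriv _ _) measurable_const)
  rw [← Measure.setLIntegral_rnDeriv hμ]
  calc ∫⁻ x in F ∩ {x | μ.rnDeriv volume x ≤ t}, μ.rnDeriv volume x
      ≤ ∫⁻ _ in F ∩ {x | μ.rnDeriv volume x ≤ t}, t :=
        setLIntegral_mono measurable_const fun x hx => hx.2
    _ = t * volume (F ∩ {x | μ.rnDeriv volume x ≤ t}) := by simp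
    _ ≤ t * volume F := by gcongr; exact inter_subset_left

theorem mul_volume_iUnion_le {μ : Measure (Fin n → ℝ)} (hμ : μ ≪ volume) {ι : Type}
    [Countable ι] {c : ι → Fin n → ℝ} {ρ : ι → ℝ} {t : ℝ≥0∞}
    (h : ∀ i, t * volume (closedBall (c i) (ρ i)) ≤ μ (closedBall (c i) (ρ i)))
    (hd : Pairwise (Function.onFun (AEDisjoint volume) fun i => closedBall (c i) (ρ i))) :
    t * volume (⋃ i, closedBall (c i) (ρ i)) ≤ μ (⋃ i, closedBall (c i) (ρ i)) := by
  rw [measure_iUnion₀ hd fun i => isClosed_closedBall.measurableSet.nullMeasurableSet,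
    measure_iUnion₀ (hd.mono fun i j h => hμ h)
      fun i => isClosed_closedBall.measurableSet.nullMeasurableSet, ← ENNReal.tsum_mul_left]
  exact ENNReal.tsum_le_tsum h

/-- The Calderón–Zygmund cubes at height `δ⁻¹` times the average fill at most the fraction `δ` of
the cube, so they carry at most half of its mass. Their own averages exceed the old one by at most
the factor `2^n δ⁻¹`, so the induction hypothesis on each of them gains one more factor of one half.
-/
theorem IsHalving.rnDeriv_decay_pow {μ : Measure (Fin n → ℝ)} [IsLocallyFiniteMeasure μ]
    (hμ : μ ≪ volume) {δ : ℝ} (hδ : 0 < δ) (hδ1 : δ ≤ 1) (h : IsHalving μ δ) (k : ℕ) :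
    ∀ (z : Fin n → ℝ) (r : ℝ), 0 < r →
      μ (closedBall z r ∩ {x | (2 ^ n * (ENNReal.ofReal δ)⁻¹) ^ k *
        (μ (closedBall z r) / volume (closedBall z r)) < μ.rnDeriv volume x}) ≤
        2⁻¹ ^ k * μ (closedBall z r) := by
  set d := ENNReal.ofReal δ with hd
  have hd0 : d ≠ 0 := by simpa [hd] using hδ
  have hdt : d ≠ ∞ := by simp [hd]
  have hd1 : 1 ≤ d⁻¹ := by
    rw [ENNReal.one_le_inv]; exact ENNReal.ofReal_le_one.2 hδ1
  induction k with
  | zero => intro z r hr; simpa using measure_mono inter_subset_left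
  | succ k ih =>
    intro z r hr
    set B := closedBall z r with hB
    have hv0 : volume B ≠ 0 := volume_cube_ne_zero z hr
    have hvt : volume B ≠ ∞ := volume_cube_ne_top z r
    have hBt : μ B ≠ ∞ := measure_closedBall_lt_top.ne
    rcases eq_or_ne (μ B) 0 with hB0 | hB0
    · rw [hB0, mul_zero, measure_mono_null inter_subset_left hB0]
    set A := μ B / volume B with hA
    have hA0 : A ≠ 0 := (ENNReal.div_pos hB0 hvt).ne'
    have hAt : A ≠ ∞ := ENNReal.div_ne_top hBt hv0
    have hAB : A * volume B = μ B := ENNReal.div_mul_cancel hv0 hvt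
    have h2n : (1 : ℝ≥0∞) ≤ 2 ^ n := one_le_pow₀ one_le_two
    obtain ⟨ι, hι, c, ρ, hρ, hsub, hlow, hup, hdis, hae⟩ :=
      exists_calderonZygmund μ z hr (t := d⁻¹ * A) (by
        rw [← hB, mul_assoc, hAB]; exact le_mul_of_one_le_left' hd1)
    set U := ⋃ i, closedBall (c i) (ρ i) with hU
    have hUB : U ⊆ B := iUnion_subset hsub
    have hUm : MeasurableSet U := MeasurableSet.iUnion fun i => isClosed_closedBall.measurableSet
    have hUvol : volume U ≤ d * volume B := by
      have h1 : d⁻¹ * A * volume U ≤ A * volume B :=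
        ((mul_volume_iUnion_le hμ (fun i => (hlow i).le) hdis).trans (measure_mono hUB)).trans
          hAB.ge
      rw [mul_comm (d⁻¹), mul_assoc, ENNReal.mul_le_mul_iff_right hA0 hAt] at h1
      calc volume U = d * (d⁻¹ * volume U) := by
            rw [← mul_assoc, ENNReal.mul_inv_cancel hd0 hdt, one_mul]
        _ ≤ d * volume B := by gcongr
    have hUμ : μ U ≤ 2⁻¹ * μ B := h z r hr U hUB hUm hUvol
    have hcov : μ (B ∩ {x | (2 ^ n * d⁻¹) ^ (k + 1) * A < μ.rnDeriv volume x}) ≤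
        μ (⋃ i, closedBall (c i) (ρ i) ∩ {x | (2 ^ n * d⁻¹) ^ k *
          (μ (closedBall (c i) (ρ i)) / volume (closedBall (c i) (ρ i))) <
            μ.rnDeriv volume x}) := by
      refine measure_mono_ae ?_
      filter_upwards [hμ.ae_le hae] with x hx
      rintro ⟨hxB, hxf⟩
      have hxf : (2 ^ n * d⁻¹) ^ (k + 1) * A < μ.rnDeriv volume x := hxf
      -- Outside the selected cubes the density is at most `d⁻¹ * A`, which is below the threshold.
      have hxU : x ∈ U := by
        by_contra hxU
        refine absurd (hx hxB hxU) (not_le.2 (lt_of_le_of_lt ?_ hxf))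
        gcongr
        calc d⁻¹ ≤ 2 ^ n * d⁻¹ := le_mul_of_one_le_left' h2n
          _ ≤ (2 ^ n * d⁻¹) ^ (k + 1) :=
            le_self_pow₀ (h2n.trans (le_mul_of_one_le_right' hd1)) (Nat.succ_ne_zero k)
      obtain ⟨i, hi⟩ := mem_iUnion.1 hxU
      refine mem_iUnion.2 ⟨i, hi, lt_of_le_of_lt ?_ hxf⟩
      rw [pow_succ, mul_assoc ((2 ^ n * d⁻¹) ^ k)]
      gcongr
      refine ENNReal.div_le_of_le_mul ((hup i).trans (le_of_eq ?_))
      ring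
    calc _ ≤ _ := hcov
      _ ≤ ∑' i, μ (closedBall (c i) (ρ i) ∩ _) := measure_iUnion_le _
      _ ≤ ∑' i, 2⁻¹ ^ k * μ (closedBall (c i) (ρ i)) :=
        ENNReal.tsum_le_tsum fun i => ih (c i) (ρ i) (hρ i)
      _ = 2⁻¹ ^ k * μ U := by
        rw [ENNReal.tsum_mul_left, hU, measure_iUnion₀ (hdis.mono fun i j h => hμ h)
          fun i => isClosed_closedBall.measurableSet.nullMeasurableSet]
      _ ≤ 2⁻¹ ^ k * (2⁻¹ * μ B) := by gcongr
      _ = 2⁻¹ ^ (k + 1) * μ B := by rw [pow_succ, mul_assoc]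

/-- The exponent of the power decay that follows from `IsHalving μ δ`. -/
noncomputable def decayExponent (n : ℕ) (δ : ℝ) : ℝ := Real.log 2 / Real.log (2 ^ n / δ)

theorem log_two_le_log_div (n : ℕ) {δ : ℝ} (hδ : 0 < δ) (hδ1 : δ ≤ 1 / 2) :
    Real.log 2 ≤ Real.log (2 ^ n / δ) := by
  apply Real.log_le_log two_pos
  rw [le_div_iff₀ hδ]
  have : (1 : ℝ) ≤ 2 ^ n := one_le_pow₀ one_le_two
  linarith

theorem decayExponent_pos (n : ℕ) {δ : ℝ} (hδ : 0 < δ) (hδ1 : δ ≤ 1 / 2) :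
    0 < decayExponent n δ :=
  div_pos (Real.log_pos one_lt_two)
    ((Real.log_pos one_lt_two).trans_le (log_two_le_log_div n hδ hδ1))

theorem decayExponent_le_one (n : ℕ) {δ : ℝ} (hδ : 0 < δ) (hδ1 : δ ≤ 1 / 2) :
    decayExponent n δ ≤ 1 :=
  (div_le_one ((Real.log_pos one_lt_two).trans_le (log_two_le_log_div n hδ hδ1))).2
    (log_two_le_log_div n hδ hδ1)

theorem IsHalving.rnDeriv_decay {μ : Measure (Fin n → ℝ)} [IsLocallyFiniteMeasure μ]
    (hμ : μ ≪ volume) {δ : ℝ} (hδ : 0 < δ) (hδ1 : δ ≤ 1 / 2) (h : IsHalving μ δ) {u : ℝ}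
    (hu : 1 ≤ u) (z : Fin n → ℝ) {r : ℝ} (hr : 0 < r) :
    μ (closedBall z r ∩ {x | ENNReal.ofReal u *
        (μ (closedBall z r) / volume (closedBall z r)) < μ.rnDeriv volume x}) ≤
      ENNReal.ofReal (2 * u ^ (-decayExponent n δ)) * μ (closedBall z r) := by
  set a : ℝ := 2 ^ n / δ with ha
  have ha0 : 0 < a := by positivity
  have hla : 0 < Real.log a := (Real.log_pos one_lt_two).trans_le (log_two_le_log_div n hδ hδ1)
  have hu0 : 0 < u := one_pos.trans_le hu
  -- The largest `k` with `a ^ k ≤ u`; rounding down costs the factor `2` in the bound.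
  set k := ⌊Real.log u / Real.log a⌋₊ with hk
  have hk1 : (k : ℝ) ≤ Real.log u / Real.log a := Nat.floor_le (div_nonneg (Real.log_nonneg hu) hla.le)
  have hk2 : Real.log u / Real.log a < k + 1 := Nat.lt_floor_add_one _
  have hak : a ^ k ≤ u := by
    rw [← Real.log_le_log_iff (by positivity) hu0, Real.log_pow]
    rwa [le_div_iff₀ hla] at hk1
  have h2k : (2 : ℝ)⁻¹ ^ k ≤ 2 * u ^ (-decayExponent n δ) := by
    rw [← Real.log_le_log_iff (by positivity) (by positivity), Real.log_pow,
      Real.log_mul two_ne_zero (by positivity), Real.log_rpow hu0, Real.log_inv, decayExponent]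
    have hl2 := Real.log_pos one_lt_two
    have := mul_lt_mul_of_pos_right hk2 hl2
    have e : Real.log u / Real.log a * Real.log 2 = Real.log 2 / Real.log a * Real.log u := by ring
    rw [e] at this
    linarith
  refine (measure_mono (inter_subset_inter_right _ fun x hx => ?_)).trans ((h.rnDeriv_decay_pow hμ hδ (by linarith) k z r hr).trans ?_)
  · rw [mem_ofPred_eq] at hx ⊢
    refine lt_of_le_of_lt ?_ hx
    gcongr
    have e : (2 : ℝ≥0∞) ^ n * (ENNReal.ofReal δ)⁻¹ = ENNReal.ofReal a := by
      rw [ha, ENNReal.ofReal_div_of_pos hδ, ENNReal.ofReal_pow zero_le_two, ENNReal.ofReal_ofNat,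
        div_eq_mul_inv]
    rw [e, ← ENNReal.ofReal_pow ha0.le]
    exact ENNReal.ofReal_le_ofReal hak
  · gcongr
    refine le_trans (le_of_eq ?_) (ENNReal.ofReal_le_ofReal h2k)
    rw [ENNReal.ofReal_pow (by positivity), ENNReal.ofReal_inv_of_pos two_pos, ENNReal.ofReal_ofNat]

/-- Split `F` at density `u = l^(-1/2)` times the average: the upper part has mass fraction at most
`2 l^(θ/2)` by the decay, and the lower part at most `u l = l^(1/2) ≤ l^(θ/2)`, since `θ ≤ 1`. -/
theorem IsHalving.measure_le {μ : Measure (Fin n → ℝ)} [IsLocallyFiniteMeasure μ]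
    (hμ : μ ≪ volume) {δ : ℝ} (hδ : 0 < δ) (hδ1 : δ ≤ 1 / 2) (h : IsHalving μ δ) {l : ℝ}
    (hl : 0 < l) {z : Fin n → ℝ} {r : ℝ} (hr : 0 < r) {F : Set (Fin n → ℝ)}
    (hFB : F ⊆ closedBall z r) (hF : MeasurableSet F)
    (hFv : volume F ≤ ENNReal.ofReal l * volume (closedBall z r)) :
    μ F ≤ ENNReal.ofReal (3 * l ^ (decayExponent n δ / 2)) * μ (closedBall z r) := by
  set θ := decayExponent n δ
  have hθ1 : θ ≤ 1 := decayExponent_le_one n hδ hδ1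
  have hθ0 : 0 < θ := decayExponent_pos n hδ hδ1
  rcases lt_or_ge 1 l with hl1 | hl1
  · refine (measure_mono hFB).trans (le_mul_of_one_le_left' (ENNReal.one_le_ofReal.2 ?_))
    have := Real.one_le_rpow hl1.le (half_pos hθ0).le
    linarith
  set u : ℝ := l ^ (-(1 / 2) : ℝ) with hu
  have hu1 : 1 ≤ u := Real.one_le_rpow_of_pos_of_le_one_of_nonpos hl hl1 (by norm_num)
  have e1 : u ^ (-θ) = l ^ (θ / 2) := by rw [hu, ← Real.rpow_mul hl.le]; congr 1; ring
  have e2 : u * l = l ^ (1 / 2 : ℝ) := by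
    rw [hu]; nth_rw 2 [← Real.rpow_one l]; rw [← Real.rpow_add hl]; norm_num
  have e3 : l ^ (1 / 2 : ℝ) ≤ l ^ (θ / 2) := Real.rpow_le_rpow_of_exponent_ge hl hl1 (by linarith)
  set B := closedBall z r with hB
  set A := μ B / volume B with hA
  have hAB : A * volume B = μ B :=
    ENNReal.div_mul_cancel (volume_cube_ne_zero z hr) (volume_cube_ne_top z r)
  have hsub : F ⊆ (B ∩ {x | ENNReal.ofReal u * A < μ.rnDeriv volume x}) ∪
      (F ∩ {x | μ.rnDeriv volume x ≤ ENNReal.ofReal u * A}) := by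
    intro x hx
    rcases lt_or_ge (ENNReal.ofReal u * A) (μ.rnDeriv volume x) with h1 | h1
    · exact Or.inl ⟨hFB hx, h1⟩
    · exact Or.inr ⟨hx, h1⟩
  calc μ F ≤ _ := measure_mono hsub
    _ ≤ _ := measure_union_le _ _
    _ ≤ ENNReal.ofReal (2 * u ^ (-θ)) * μ B + ENNReal.ofReal u * A * (ENNReal.ofReal l * volume B) :=
      add_le_add (h.rnDeriv_decay hμ hδ hδ1 hu1 z hr)
        ((measure_inter_rnDeriv_le μ hμ hF _).trans (by gcongr))
    _ = ENNReal.ofReal (2 * u ^ (-θ)) * μ B + ENNReal.ofReal (u * l) * μ B := by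
      rw [ENNReal.ofReal_mul (by positivity : 0 ≤ u), ← hAB]; ring
    _ = ENNReal.ofReal (2 * u ^ (-θ) + u * l) * μ B := by
      rw [ENNReal.ofReal_add (by positivity) (by positivity), add_mul]
    _ ≤ _ := by
      gcongr
      rw [e1, e2]; linarith

end Decay

/-! ### Layer cake formula. -/

theorem lintegral_Ioi_indicator_lt (m : ℝ≥0∞) :
    ∫⁻ s in Ioi (0 : ℝ), {s : ℝ | ENNReal.ofReal s < m}.indicator (fun _ => (1 : ℝ≥0∞)) s = m := by
  have hm : MeasurableSet {s : ℝ | ENNReal.ofReal s < m} :=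
    measurableSet_lt ENNReal.measurable_ofReal measurable_const
  rw [lintegral_indicator hm, setLIntegral_one, Measure.restrict_apply hm]
  rcases eq_or_ne m ∞ with rfl | hmt
  · simp
  · have : {s : ℝ | ENNReal.ofReal s < m} ∩ Ioi 0 = Ioo 0 m.toReal := by
      ext s
      simp only [mem_inter_iff, mem_ofPred_eq, mem_Ioi, mem_Ioo]
      constructor
      · rintro ⟨h1, h2⟩
        exact ⟨h2, (ENNReal.ofReal_lt_iff_lt_toReal h2.le hmt).1 h1⟩
      · rintro ⟨h1, h2⟩
        exact ⟨(ENNReal.ofReal_lt_iff_lt_toReal h1.le hmt).2 h2, h1⟩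
    rw [this, Real.volume_Ioo, sub_zero, ENNReal.ofReal_toReal hmt]

/-- The layer cake formula for functions with values in `ℝ≥0∞`. -/
theorem lintegral_eq_lintegral_Ioi_meas_lt {α : Type*} [MeasurableSpace α] (ν : Measure α)
    [SFinite ν] {g : α → ℝ≥0∞} (hg : Measurable g) :
    ∫⁻ x, g x ∂ν = ∫⁻ s in Ioi (0 : ℝ), ν {x | ENNReal.ofReal s < g x} := by
  have hm : MeasurableSet {p : α × ℝ | ENNReal.ofReal p.2 < g p.1} :=
    measurableSet_lt (ENNReal.measurable_ofReal.comp measurable_snd) (hg.comp measurable_fst)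
  calc ∫⁻ x, g x ∂ν = ∫⁻ x, (∫⁻ s in Ioi (0 : ℝ),
        {p : α × ℝ | ENNReal.ofReal p.2 < g p.1}.indicator (fun _ => (1 : ℝ≥0∞)) (x, s)) ∂ν :=
        lintegral_congr fun x => (lintegral_Ioi_indicator_lt (g x)).symm
    _ = ∫⁻ s in Ioi (0 : ℝ), ∫⁻ x,
        {p : α × ℝ | ENNReal.ofReal p.2 < g p.1}.indicator (fun _ => (1 : ℝ≥0∞)) (x, s) ∂ν :=
        lintegral_lintegral_swap (measurable_const.indicator hm).aemeasurable
    _ = _ := by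
        refine lintegral_congr fun s => ?_
        have hs : MeasurableSet {x | ENNReal.ofReal s < g x} := measurableSet_lt measurable_const hg
        calc _ = ∫⁻ x, {x | ENNReal.ofReal s < g x}.indicator (fun _ => (1 : ℝ≥0∞)) x ∂ν := rfl
          _ = _ := by rw [lintegral_indicator hs, setLIntegral_one]

/-! ### From the Fujii–Wilson constant to halving. -/

section FujiiWilson

variable {n : ℕ}

/-- A reverse weak type inequality: the Calderón–Zygmund cubes at height `t` cover almost all of the
set where the density exceeds `t`, lie in the superlevel set of the localized maximal function, and
have average at most `2^n t`. -/
theorem measure_lt_rnDeriv_le_cubeMax {μ : Measure (Fin n → ℝ)} [IsLocallyFiniteMeasure μ]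
    (hμ : μ ≪ volume) {z : Fin n → ℝ} {r : ℝ} (hr : 0 < r) {t : ℝ≥0∞}
    (ht : μ (closedBall z r) ≤ t * volume (closedBall z r)) :
    μ (closedBall z r ∩ {x | t < μ.rnDeriv volume x}) ≤ 2 ^ n * t *
      volume (closedBall z r ∩ {x | t < cubeMax (μ.restrict (closedBall z r)) x}) := by
  obtain ⟨ι, hι, c, ρ, hρ, hsub, hlow, hup, hdis, hae⟩ := exists_calderonZygmund μ z hr ht
  calc μ (closedBall z r ∩ {x | t < μ.rnDeriv volume x})
      ≤ μ (⋃ i, closedBall (c i) (ρ i)) := by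
        refine measure_mono_ae ?_
        filter_upwards [hμ.ae_le hae] with x hx
        rintro ⟨hxB, hxf⟩
        by_contra hxU
        exact absurd (hx hxB hxU) (not_le.2 hxf)
    _ ≤ ∑' i, μ (closedBall (c i) (ρ i)) := measure_iUnion_le _
    _ ≤ ∑' i, 2 ^ n * t * volume (closedBall (c i) (ρ i)) := ENNReal.tsum_le_tsum hup
    _ = 2 ^ n * t * volume (⋃ i, closedBall (c i) (ρ i)) := by
        rw [ENNReal.tsum_mul_left,
          measure_iUnion₀ hdis fun i => isClosed_closedBall.measurableSet.nullMeasurableSet]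
    _ ≤ _ := by
        gcongr
        refine iUnion_subset fun i x hx => ⟨hsub i hx, ?_⟩
        refine lt_cubeMax_iff.2 ⟨c i, ρ i, hρ i, hx, ?_⟩
        rw [Measure.restrict_apply isClosed_closedBall.measurableSet,
          inter_eq_left.2 (hsub i)]
        exact hlow i

theorem lintegral_inv_Ioc {L : ℝ} (hL : 1 ≤ L) :
    ∫⁻ s in Ioc 1 L, ENNReal.ofReal s⁻¹ = ENNReal.ofReal (Real.log L) := by
  rw [← ofReal_integral_eq_lintegral_ofReal, ← intervalIntegral.integral_of_le hL,
    integral_inv_of_pos one_pos (one_pos.trans_le hL), div_one]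
  · change IntegrableOn (fun s : ℝ => s⁻¹) (Ioc 1 L) volume
    rw [← intervalIntegrable_iff_integrableOn_Ioc_of_le hL]
    refine intervalIntegral.intervalIntegrable_inv (f := fun s : ℝ => s) (fun x hx => ?_) continuousOn_id
    rw [uIcc_of_le hL] at hx
    exact (one_pos.trans_le hx.1).ne'
  · filter_upwards [ae_restrict_mem measurableSet_Ioc] with s hs
    exact inv_nonneg.2 (zero_le_one.trans hs.1.le)

/-- A Fujii–Wilson bound makes the top part of the density carry little mass. -/
theorem log_mul_measure_le {μ : Measure (Fin n → ℝ)} [IsLocallyFiniteMeasure μ]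
    (hμ : μ ≪ volume) {z : Fin n → ℝ} {r : ℝ} (hr : 0 < r) {W : ℝ≥0∞}
    (hW : ∫⁻ x in closedBall z r, cubeMax (μ.restrict (closedBall z r)) x ≤
      W * μ (closedBall z r)) {L : ℝ} (hL : 1 ≤ L) :
    ENNReal.ofReal (Real.log L) * μ (closedBall z r ∩ {x | ENNReal.ofReal L *
      (μ (closedBall z r) / volume (closedBall z r)) < μ.rnDeriv volume x}) ≤
      2 ^ n * W * μ (closedBall z r) := by
  set B := closedBall z r with hB
  have hv0 : volume B ≠ 0 := volume_cube_ne_zero z hr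
  have hvt : volume B ≠ ∞ := volume_cube_ne_top z r
  have hBt : μ B ≠ ∞ := measure_closedBall_lt_top.ne
  rcases eq_or_ne (μ B) 0 with hB0 | hB0
  · rw [hB0, mul_zero, measure_mono_null inter_subset_left hB0, mul_zero]
  set A := μ B / volume B with hA
  have hA0 : A ≠ 0 := (ENNReal.div_pos hB0 hvt).ne'
  have hAt : A ≠ ∞ := ENNReal.div_ne_top hBt hv0
  have hAB : A * volume B = μ B := ENNReal.div_mul_cancel hv0 hvt
  set M := cubeMax (μ.restrict B) with hM
  have hMm : Measurable M := measurable_cubeMax _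
  set G := B ∩ {x | ENNReal.ofReal L * A < μ.rnDeriv volume x} with hG
  -- The set `G` has density above every level `s * A` with `s ≤ L`, so the same mass `μ G` is
  -- counted at each height; integrating `ds / s` produces the logarithm.
  have key : ∀ s ∈ Ioc 1 L, ENNReal.ofReal s⁻¹ * μ G ≤
      2 ^ n * A * (volume.restrict B) {x | ENNReal.ofReal s < M x / A} := by
    intro s hs
    have hs0 : 0 < s := one_pos.trans hs.1
    have e : {x | ENNReal.ofReal s < M x / A} = {x | ENNReal.ofReal s * A < M x} := by
      ext x
      simp only [mem_ofPred_eq]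
      rw [ENNReal.lt_div_iff_mul_lt (Or.inl hA0) (Or.inl hAt)]
    have hm : MeasurableSet {x | ENNReal.ofReal s * A < M x} :=
      measurableSet_lt measurable_const hMm
    have h1 : μ G ≤ 2 ^ n * (ENNReal.ofReal s * A) * volume (B ∩ {x | ENNReal.ofReal s * A < M x}) := by
      refine le_trans (measure_mono (inter_subset_inter_right _ fun x hx => ?_))
        (measure_lt_rnDeriv_le_cubeMax hμ hr (t := ENNReal.ofReal s * A) ?_)
      · rw [mem_ofPred_eq] at hx ⊢
        refine lt_of_le_of_lt ?_ hx
        gcongr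
        exact hs.2
      · rw [mul_assoc, hAB]
        exact le_mul_of_one_le_left' (ENNReal.one_le_ofReal.2 hs.1.le)
    rw [e, Measure.restrict_apply hm, inter_comm]
    calc ENNReal.ofReal s⁻¹ * μ G ≤ ENNReal.ofReal s⁻¹ * (2 ^ n * (ENNReal.ofReal s * A) *
          volume (B ∩ {x | ENNReal.ofReal s * A < M x})) := by gcongr
      _ = (ENNReal.ofReal s⁻¹ * ENNReal.ofReal s) * (2 ^ n * A *
          volume (B ∩ {x | ENNReal.ofReal s * A < M x})) := by ring
      _ = _ := by
        rw [← ENNReal.ofReal_mul (inv_nonneg.2 hs0.le), inv_mul_cancel₀ hs0.ne',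
          ENNReal.ofReal_one, one_mul]
  calc ENNReal.ofReal (Real.log L) * μ G
      = ∫⁻ s in Ioc 1 L, ENNReal.ofReal s⁻¹ * μ G := by
        rw [lintegral_mul_const' _ _ (ne_top_of_le_ne_top hBt (measure_mono inter_subset_left)),
          lintegral_inv_Ioc hL]
    _ ≤ ∫⁻ s in Ioc 1 L, 2 ^ n * A * (volume.restrict B) {x | ENNReal.ofReal s < M x / A} :=
        setLIntegral_mono' measurableSet_Ioc key
    _ ≤ ∫⁻ s in Ioi 0, 2 ^ n * A * (volume.restrict B) {x | ENNReal.ofReal s < M x / A} :=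
        lintegral_mono_set fun s hs => one_pos.trans hs.1
    _ = 2 ^ n * A * ∫⁻ x in B, M x / A := by
        rw [lintegral_const_mul' _ _ (ENNReal.mul_ne_top (by simp) hAt),
          lintegral_eq_lintegral_Ioi_meas_lt _ (hMm.div_const A)]
    _ = 2 ^ n * ∫⁻ x in B, M x := by
        simp only [div_eq_mul_inv]
        rw [lintegral_mul_const _ hMm, mul_assoc, mul_left_comm A, ENNReal.mul_inv_cancel hA0 hAt,
          mul_one]
    _ ≤ _ := by rw [mul_assoc]; gcongr

/-- With `log L = 2^(n+2) W`, densities above `L` times the average carry at most a quarter of the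
mass. The rest of `F` carries at most `L δ`, again a quarter. -/
theorem isHalving_of_fujiiWilson {μ : Measure (Fin n → ℝ)} [IsLocallyFiniteMeasure μ]
    (hμ : μ ≪ volume) {W : ℝ} (hW0 : 0 < W)
    (hW : ∀ (z : Fin n → ℝ) (r : ℝ), 0 < r →
      ∫⁻ x in closedBall z r, cubeMax (μ.restrict (closedBall z r)) x ≤
        ENNReal.ofReal W * μ (closedBall z r)) :
    IsHalving μ (Real.exp (-(2 ^ (n + 2) * W)) / 4) := by
  intro z r hr F hFB hF hFv
  set L : ℝ := Real.exp (2 ^ (n + 2) * W) with hLdef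
  have hL : 1 ≤ L := Real.one_le_exp (by positivity)
  have h := log_mul_measure_le hμ hr (hW z r hr) hL
  set B := closedBall z r with hB
  set A := μ B / volume B with hA
  have hAB : A * volume B = μ B :=
    ENNReal.div_mul_cancel (volume_cube_ne_zero z hr) (volume_cube_ne_top z r)
  have h4 : (4 : ℝ≥0∞) * μ (B ∩ {x | ENNReal.ofReal L * A < μ.rnDeriv volume x}) ≤ μ B := by
    have e : ENNReal.ofReal (Real.log L) = 2 ^ n * ENNReal.ofReal W * 4 := by
      rw [hLdef, Real.log_exp, ENNReal.ofReal_mul (by positivity),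
        ENNReal.ofReal_pow zero_le_two, ENNReal.ofReal_ofNat, pow_add]
      ring
    rw [e, mul_assoc, ENNReal.mul_le_mul_iff_right] at h
    · exact h
    · simp [hW0]
    · exact ENNReal.mul_ne_top (by simp) (by simp)
  have hsub : F ⊆ (B ∩ {x | ENNReal.ofReal L * A < μ.rnDeriv volume x}) ∪
      (F ∩ {x | μ.rnDeriv volume x ≤ ENNReal.ofReal L * A}) := by
    intro x hx
    rcases lt_or_ge (ENNReal.ofReal L * A) (μ.rnDeriv volume x) with h1 | h1
    · exact Or.inl ⟨hFB hx, h1⟩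
    · exact Or.inr ⟨hx, h1⟩
  have h41 : μ (B ∩ {x | ENNReal.ofReal L * A < μ.rnDeriv volume x}) ≤ ENNReal.ofReal (1 / 4) * μ B := by
    calc _ = ENNReal.ofReal (1 / 4) * (4 * μ (B ∩ {x | ENNReal.ofReal L * A < μ.rnDeriv volume x})) := by
          rw [← mul_assoc, ← ENNReal.ofReal_ofNat, ← ENNReal.ofReal_mul (by norm_num)]
          norm_num
      _ ≤ _ := by gcongr
  calc μ F ≤ _ := measure_mono hsub
    _ ≤ _ := measure_union_le _ _
    _ ≤ ENNReal.ofReal (1 / 4) * μ B + ENNReal.ofReal L * A *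
        (ENNReal.ofReal (Real.exp (-(2 ^ (n + 2) * W)) / 4) * volume B) :=
      add_le_add h41 ((measure_inter_rnDeriv_le μ hμ hF _).trans (by gcongr))
    _ = ENNReal.ofReal (1 / 4) * μ B +
        ENNReal.ofReal (L * (Real.exp (-(2 ^ (n + 2) * W)) / 4)) * μ B := by
      rw [ENNReal.ofReal_mul (by positivity : 0 ≤ L), ← hAB]; ring
    _ = 2⁻¹ * μ B := by
      rw [hLdef, mul_div_assoc', ← Real.exp_add, add_neg_cancel, Real.exp_zero, ← add_mul,
        ← ENNReal.ofReal_add (by norm_num) (by norm_num)]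
      congr 1
      rw [← ENNReal.ofReal_ofNat 2, ← ENNReal.ofReal_inv_of_pos two_pos]
      norm_num

end FujiiWilson

theorem le_two_mul_of_le_half_add {a b : ℝ≥0∞} (ha : a ≠ ∞) (h : a ≤ 2⁻¹ * a + b) : a ≤ 2 * b := by
  have h3 : 2⁻¹ * a + 2⁻¹ * a = a := by rw [← add_mul, ENNReal.inv_two_add_inv_two, one_mul]
  have h2 : 2⁻¹ * a ≤ b :=
    (ENNReal.add_le_add_iff_left (ENNReal.mul_ne_top (by simp) ha)).1 (h3.trans_le h)
  rw [← h3, two_mul]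
  exact add_le_add h2 h2

/-! ### Halving implies doubling. -/

section Doubling

variable {n : ℕ}

/-- Since `δ` may be small, halving does not apply directly to `2Q \ Q`. For `q` close to `1`,
however, the shell `qQ \ Q` fills at most the fraction `δ` of `qQ`. Iteration then reaches the
factor `2`. -/
theorem IsHalving.exists_enlarge {μ : Measure (Fin n → ℝ)} [IsLocallyFiniteMeasure μ] {δ : ℝ}
    (hδ : 0 < δ) (h : IsHalving μ δ) : ∃ q : ℝ, 1 < q ∧ ∀ (z : Fin n → ℝ) (r : ℝ), 0 < r →
      μ (closedBall z (q * r)) ≤ 2 * μ (closedBall z r) := by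
  -- This gives `q ^ n ≤ exp δ`, hence a shell fraction of at most `1 - exp (-δ) ≤ δ`.
  set q := Real.exp (δ / (n + 1)) with hq
  have hq1 : 1 < q := Real.one_lt_exp_iff.2 (by positivity)
  refine ⟨q, hq1, fun z r hr => ?_⟩
  have hqn : q ^ n ≤ δ * q ^ n + 1 := by
    have h1 : q ^ n ≤ Real.exp δ := by
      rw [hq, ← Real.exp_nat_mul]
      apply Real.exp_le_exp.2
      rw [mul_div_assoc', div_le_iff₀ (by positivity)]
      linarith
    have h2 := Real.one_sub_le_exp_neg δ
    have h3 : q ^ n * (1 - δ) ≤ 1 := by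
      calc q ^ n * (1 - δ) ≤ q ^ n * Real.exp (-δ) := by gcongr
        _ ≤ Real.exp δ * Real.exp (-δ) := by gcongr
        _ = 1 := by rw [← Real.exp_add, add_neg_cancel, Real.exp_zero]
    linarith
  have hsub : closedBall z r ⊆ closedBall z (q * r) :=
    closedBall_subset_closedBall (le_mul_of_one_le_left hr.le hq1.le)
  have hF : μ (closedBall z (q * r) \ closedBall z r) ≤ 2⁻¹ * μ (closedBall z (q * r)) := by
    refine h z (q * r) (by positivity) _ sdiff_subset
      (isClosed_closedBall.measurableSet.diff isClosed_closedBall.measurableSet) ?_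
    rw [measure_sdiff hsub isClosed_closedBall.measurableSet.nullMeasurableSet
      (volume_cube_ne_top z r), volume_cube_mul z z hr.le (by positivity), tsub_le_iff_right,
      ← mul_assoc, ← ENNReal.ofReal_mul hδ.le]
    calc ENNReal.ofReal (q ^ n) * volume (closedBall z r)
        ≤ ENNReal.ofReal (δ * q ^ n + 1) * volume (closedBall z r) := by gcongr
      _ = _ := by
        rw [ENNReal.ofReal_add (by positivity) zero_le_one, add_mul, ENNReal.ofReal_one, one_mul]
  have hfin : μ (closedBall z (q * r)) ≠ ∞ := measure_closedBall_lt_top.ne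
  have h1 : μ (closedBall z (q * r)) ≤ 2⁻¹ * μ (closedBall z (q * r)) + μ (closedBall z r) := by
    calc _ ≤ μ ((closedBall z (q * r) \ closedBall z r) ∪ closedBall z r) :=
          measure_mono (by rw [sdiff_union_self]; exact subset_union_left)
      _ ≤ _ := (measure_union_le _ _).trans (by gcongr)
  exact le_two_mul_of_le_half_add hfin h1

theorem IsHalving.exists_pow_enlarge {μ : Measure (Fin n → ℝ)} [IsLocallyFiniteMeasure μ] {δ : ℝ}
    (hδ : 0 < δ) (h : IsHalving μ δ) : ∃ q : ℝ, 1 < q ∧ ∀ (k : ℕ) (z : Fin n → ℝ) (r : ℝ), 0 < r →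
      μ (closedBall z (q ^ k * r)) ≤ 2 ^ k * μ (closedBall z r) := by
  obtain ⟨q, hq, hq2⟩ := h.exists_enlarge hδ
  refine ⟨q, hq, fun k z r hr => ?_⟩
  induction k with
  | zero => simp
  | succ k ih =>
    rw [pow_succ', pow_succ', mul_assoc, mul_assoc]
    exact (hq2 z _ (by positivity)).trans (by gcongr)

theorem IsHalving.exists_doubling {μ : Measure (Fin n → ℝ)} [IsLocallyFiniteMeasure μ] {δ : ℝ}
    (hδ : 0 < δ) (h : IsHalving μ δ) : ∃ D : ℝ≥0∞, D ≠ ∞ ∧ ∀ (z : Fin n → ℝ) (r : ℝ), 0 < r →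
      μ (closedBall z (2 * r)) ≤ D * μ (closedBall z r) := by
  obtain ⟨q, hq, hq2⟩ := h.exists_pow_enlarge hδ
  obtain ⟨k, hk⟩ := pow_unbounded_of_one_lt 2 hq
  refine ⟨2 ^ k, by simp, fun z r hr => (measure_mono ?_).trans (hq2 k z r hr)⟩
  exact closedBall_subset_closedBall (by gcongr)

end Doubling

/-! ### Kneser inequality and Vitali selection for cubes. -/

section Kneser

variable {n : ℕ}

/-- A **Kneser type inequality**: dilating the members of a finite family of cubes about their own
centres by the factor `t ≥ 1` multiplies the volume of the union by at most `t ^ n`. -/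
theorem volume_biUnion_dilate_le {ι : Type*} (s : Finset ι) (x : ι → Fin n → ℝ) (ρ : ι → ℝ) {t : ℝ}
    (ht : 1 ≤ t) :
    volume (⋃ i ∈ s, closedBall (x i) (t * ρ i)) ≤
      ENNReal.ofReal (t ^ n) * volume (⋃ i ∈ s, closedBall (x i) (ρ i)) := by
  classical
  let _ : LinearOrder ι := linearOrderOfSTO WellOrderingRel
  have ht0 : 0 < t := one_pos.trans_le ht
  -- Additively weighted Voronoi cells: `C j` is the set where `d j` is minimal among the family and
  -- `j` is the least minimizer. The well-order breaks ties and makes the cells disjoint.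
  set d : ι → (Fin n → ℝ) → ℝ := fun i y => dist y (x i) - t * ρ i with hd
  set C : ι → Set (Fin n → ℝ) := fun j =>
    ⋂ i ∈ s, ({y | d j y ≤ d i y} ∩ {y | i < j → d j y < d i y}) with hC
  have hdc : ∀ i, Continuous (d i) := fun i => by simp only [hd]; fun_prop
  have hCm : ∀ j, MeasurableSet (C j) := fun j =>
    Finset.measurableSet_biInter _ fun i _ => by
      refine (isClosed_le (hdc j) (hdc i)).measurableSet.inter ?_
      by_cases hij : i < j
      · simpa [hij] using (isOpen_lt (hdc j) (hdc i)).measurableSet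
      · simp [hij]
  have hmemC : ∀ j y, y ∈ C j ↔ ∀ i ∈ s, d j y ≤ d i y ∧ (i < j → d j y < d i y) := by
    intro j y; simp [hC]
  have hdisj : (s : Set ι).PairwiseDisjoint fun j => C j ∩ closedBall (x j) (ρ j) := by
    intro i hi j hj hij
    refine Set.disjoint_left.2 fun y hy hy' => ?_
    have h1 := (hmemC i y).1 hy.1
    have h2 := (hmemC j y).1 hy'.1
    rcases lt_or_gt_of_ne hij with h | h
    · exact absurd ((h2 i hi).2 h) (not_lt.2 (h1 j hj).1)
    · exact absurd ((h1 j hj).2 h) (not_lt.2 (h2 i hi).1)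
  have hcov : (⋃ i ∈ s, closedBall (x i) (t * ρ i)) ⊆
      ⋃ j ∈ s, C j ∩ closedBall (x j) (t * ρ j) := by
    intro y hy
    simp only [mem_iUnion] at hy
    obtain ⟨i, hi, hyi⟩ := hy
    obtain ⟨j, hj, hmin⟩ := s.exists_min_image (fun i => toLex (d i y, i)) ⟨i, hi⟩
    have hjC : y ∈ C j := by
      rw [hmemC]
      intro k hk
      have := Prod.Lex.le_iff.1 (hmin k hk)
      simp only [ofLex_toLex] at this
      rcases this with h | ⟨h, h'⟩
      · exact ⟨h.le, fun _ => h⟩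
      · exact ⟨h.le, fun hkj => absurd hkj (not_lt.2 h')⟩
    refine mem_biUnion hj ⟨hjC, ?_⟩
    have h1 := ((hmemC j y).1 hjC i hi).1
    have h2 : dist y (x i) ≤ t * ρ i := hyi
    rw [mem_closedBall]
    simp only [hd] at h1
    linarith
  have hshrink : ∀ j, volume (C j ∩ closedBall (x j) (t * ρ j)) ≤
      ENNReal.ofReal (t ^ n) * volume (C j ∩ closedBall (x j) (ρ j)) := by
    intro j
    -- Each cell is star-shaped about its centre: moving straight towards `x j` lowers `d j` by
    -- exactly the distance moved, and any other `d i` by no more than that.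
    have hsub : AffineMap.homothety (x j) t⁻¹ '' (C j ∩ closedBall (x j) (t * ρ j)) ⊆
        C j ∩ closedBall (x j) (ρ j) := by
      rintro _ ⟨y, ⟨hyC, hyB⟩, rfl⟩
      set y' := AffineMap.homothety (x j) t⁻¹ y with hy'
      have e1 : dist y' (x j) = t⁻¹ * dist y (x j) := by
        rw [hy', dist_homothety_center, Real.norm_of_nonneg (inv_nonneg.2 ht0.le), dist_comm]
      have e2 : dist y y' = (1 - t⁻¹) * dist y (x j) := by
        rw [hy', dist_self_homothety, dist_comm (x j),
          Real.norm_of_nonneg (sub_nonneg.2 (inv_le_one_of_one_le₀ ht))]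
      constructor
      · rw [hmemC] at hyC ⊢
        intro i hi
        obtain ⟨h1, h2⟩ := hyC i hi
        have h3 := dist_triangle y y' (x i)
        simp only [hd] at h1 h2 ⊢
        rw [e1]
        rw [e2] at h3
        refine ⟨by linarith, fun hij => ?_⟩
        have := h2 hij
        linarith
      · rw [mem_closedBall] at hyB ⊢
        rw [e1, inv_mul_le_iff₀ ht0]
        exact hyB
    have h := measure_mono (μ := volume) hsub
    rw [Measure.addHaar_image_homothety, Module.finrank_fin_fun, abs_of_pos (by positivity)] at h
    calc volume (C j ∩ closedBall (x j) (t * ρ j)) = ENNReal.ofReal (t ^ n) *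
          (ENNReal.ofReal (t⁻¹ ^ n) * volume (C j ∩ closedBall (x j) (t * ρ j))) := by
          rw [← mul_assoc, ← ENNReal.ofReal_mul (by positivity), ← mul_pow,
            mul_inv_cancel₀ ht0.ne', one_pow, ENNReal.ofReal_one, one_mul]
      _ ≤ _ := by gcongr
  calc _ ≤ _ := measure_mono hcov
    _ ≤ ∑ j ∈ s, volume (C j ∩ closedBall (x j) (t * ρ j)) := measure_biUnion_finset_le _ _
    _ ≤ ∑ j ∈ s, ENNReal.ofReal (t ^ n) * volume (C j ∩ closedBall (x j) (ρ j)) :=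
      Finset.sum_le_sum fun j _ => hshrink j
    _ = ENNReal.ofReal (t ^ n) * volume (⋃ j ∈ s, C j ∩ closedBall (x j) (ρ j)) := by
      rw [← Finset.mul_sum, measure_biUnion_finset hdisj
        fun j _ => (hCm j).inter isClosed_closedBall.measurableSet]
    _ ≤ _ := by
      gcongr with j hj
      exact inter_subset_right

theorem exists_vitali_subfamily {ι : Type*} (t : Set ι) (x : ι → Fin n → ℝ) (r : ι → ℝ) {R : ℝ}
    (hr : ∀ a ∈ t, 0 < r a) (hR : ∀ a ∈ t, r a ≤ R) :
    ∃ u ⊆ t, u.Countable ∧ (u.PairwiseDisjoint fun a => closedBall (x a) (r a)) ∧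
      ∀ a ∈ t, ∃ b ∈ u, closedBall (x a) (r a) ⊆ closedBall (x b) (4 * r b) := by
  obtain ⟨u, hut, hd, hc⟩ := Vitali.exists_disjoint_subfamily_covering_enlargement_closedBall t x r R
    hR 4 (by norm_num)
  refine ⟨u, hut, hd.countable_of_nonempty_interior fun a ha => ?_, hd, hc⟩
  rw [interior_closedBall _ (hr a (hut ha)).ne']
  exact ⟨x a, mem_ball_self (hr a (hut ha))⟩

end Kneser

/-! ### Solyanik estimate for Lebesgue measure. -/

section Solyanik

variable {n : ℕ}

/-- A **Solyanik estimate** for Lebesgue measure inside a cube: if each cube of a finite family has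
only the fraction `l` of its volume outside `E`, then the union of the family exceeds `E` only by a
set of small volume. -/
theorem volume_biUnion_diff_le (hn : 1 ≤ n) {ι : Type*} (s : Finset ι) (x : ι → Fin n → ℝ)
    (ρ : ι → ℝ) (hρ : ∀ i ∈ s, 0 < ρ i) {Z : Fin n → ℝ} {R : ℝ}
    (hsub : ∀ i ∈ s, closedBall (x i) (ρ i) ⊆ closedBall Z R) (E : Set (Fin n → ℝ))
    {l : ℝ} (hl : 0 < l) (hl1 : l ≤ 1)
    (h : ∀ i ∈ s, volume (closedBall (x i) (ρ i) \ E) ≤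
      ENNReal.ofReal l * volume (closedBall (x i) (ρ i))) :
    volume ((⋃ i ∈ s, closedBall (x i) (ρ i)) \ E) ≤
      ENNReal.ofReal ((n + 4 ^ n) * l ^ (1 / (2 * n : ℝ))) * volume (closedBall Z R) := by
  classical
  have hn0 : (n : ℝ) ≠ 0 := by positivity
  -- Chosen so that `l = ε^(2n)`: one factor `ε^n` pays for passing to cubes of relative size `ε`,
  -- the other remains as the gain.
  set ε : ℝ := l ^ (1 / (2 * n : ℝ)) with hε
  have hε0 : 0 < ε := by positivity
  have hε1 : ε ≤ 1 := Real.rpow_le_one hl.le hl1 (by positivity)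
  have hUR : (⋃ i ∈ s, closedBall (x i) (ρ i)) ⊆ closedBall Z R := iUnion₂_subset hsub
  rcases hε1.eq_or_lt with hε1 | hε1
  · refine (measure_mono (sdiff_subset.trans hUR)).trans
      (le_mul_of_one_le_left' (ENNReal.one_le_ofReal.2 ?_))
    have : (1 : ℝ) ≤ 4 ^ n := one_le_pow₀ (by norm_num)
    rw [hε1, mul_one]
    have : (0 : ℝ) ≤ n := Nat.cast_nonneg n
    linarith
  have h1ε : 0 < 1 - ε := sub_pos.2 hε1
  have hεn : l = ε ^ n * ε ^ n := by
    rw [hε, ← Real.rpow_mul_natCast hl.le, ← Real.rpow_add hl]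
    field_simp
    norm_num
  set U := ⋃ i ∈ s, closedBall (x i) (ρ i) with hU
  set V := ⋃ i ∈ s, closedBall (x i) ((1 - ε) * ρ i) with hV
  have hVm : MeasurableSet V :=
    Finset.measurableSet_biUnion _ fun i _ => isClosed_closedBall.measurableSet
  have hVU : V ⊆ U := iUnion₂_mono fun i hi => closedBall_subset_closedBall
    (mul_le_of_le_one_left (hρ i hi).le (by linarith))
  have hUt : volume U ≠ ∞ := ne_top_of_le_ne_top (volume_cube_ne_top Z R) (measure_mono hUR)
  -- By the Kneser inequality, shrinking all the cubes by `1 - ε` loses at most the fraction `1 - (1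
  -- - ε)^n ≤ n ε` of the union.
  have hUV : volume (U \ V) ≤ ENNReal.ofReal (n * ε) * volume (closedBall Z R) := by
    have h1 := volume_biUnion_dilate_le s x (fun i => (1 - ε) * ρ i) (t := (1 - ε)⁻¹)
      ((one_le_inv₀ h1ε).2 (by linarith))
    simp only [inv_mul_cancel_left₀ h1ε.ne'] at h1
    have h2 : ENNReal.ofReal (1 - n * ε) * volume U ≤ volume V := by
      calc ENNReal.ofReal (1 - n * ε) * volume U
          ≤ ENNReal.ofReal ((1 - ε) ^ n) * (ENNReal.ofReal ((1 - ε)⁻¹ ^ n) * volume V) := by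
            gcongr
            have := one_add_mul_le_pow (a := -ε) (by linarith) n
            rw [← sub_eq_add_neg] at this
            linarith
        _ = volume V := by
            rw [← mul_assoc, ← ENNReal.ofReal_mul (by positivity), ← mul_pow,
              mul_inv_cancel₀ h1ε.ne', one_pow, ENNReal.ofReal_one, one_mul]
    rw [measure_sdiff hVU hVm.nullMeasurableSet (ne_top_of_le_ne_top hUt (measure_mono hVU)),
      tsub_le_iff_right]
    calc volume U = ENNReal.ofReal 1 * volume U := by simp
      -- The maximum covers the case `n ε > 1`, where `ENNReal.ofReal (1 - n * ε)` is zero.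
      _ ≤ ENNReal.ofReal (n * ε + max (1 - n * ε) 0) * volume U := by
          gcongr
          have := le_max_left (1 - n * ε) 0
          linarith
      _ = ENNReal.ofReal (n * ε) * volume U + ENNReal.ofReal (1 - n * ε) * volume U := by
          rw [ENNReal.ofReal_add (by positivity) (le_max_right _ _), add_mul, ENNReal.ofReal_max]
          simp
      _ ≤ _ := by gcongr
  have hVE : volume (V \ E) ≤ ENNReal.ofReal (4 ^ n * ε) * volume (closedBall Z R) := by
    have hch : ∀ y : ↥(V \ E), ∃ i ∈ s, y.1 ∈ closedBall (x i) ((1 - ε) * ρ i) := by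
      rintro ⟨y, hy, -⟩
      simpa [hV] using hy
    choose i his hi using hch
    obtain ⟨M, hM⟩ := (s.image ρ).exists_le
    -- Every point of the shrunken union is the centre of a cube of radius `ε ρ` inside an original
    -- cube. A Vitali selection among the quarter-size cubes keeps the sum of volumes below that of
    -- the ambient cube.
    have hball : ∀ y : ↥(V \ E), closedBall y.1 (ε * ρ (i y)) ⊆ closedBall (x (i y)) (ρ (i y)) := by
      intro y
      apply closedBall_subset_closedBall'
      have : dist y.1 (x (i y)) ≤ (1 - ε) * ρ (i y) := hi y
      linarith
    obtain ⟨u, -, huc, hud, hcov⟩ := exists_vitali_subfamily (univ : Set ↥(V \ E)) (fun y => y.1)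
      (fun y => ε * ρ (i y) / 4) (R := M)
      (fun y _ => by have := hρ _ (his y); positivity)
      (fun y _ => by
        have h1 := hρ _ (his y)
        have h2 : ρ (i y) ≤ M := hM _ (Finset.mem_image_of_mem ρ (his y))
        have : ε * ρ (i y) ≤ 1 * ρ (i y) := by gcongr
        linarith)
    have hone : ∀ y : ↥(V \ E), volume (closedBall y.1 (ε * ρ (i y)) \ E) ≤
        ENNReal.ofReal (4 ^ n * ε ^ n) * volume (closedBall y.1 (ε * ρ (i y) / 4)) := by
      intro y
      have h1 := hρ _ (his y)
      calc _ ≤ volume (closedBall (x (i y)) (ρ (i y)) \ E) :=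
            measure_mono (sdiff_subset_sdiff_left (hball y))
        _ ≤ _ := h _ (his y)
        _ = ENNReal.ofReal l * volume (closedBall (x (i y)) (4 / ε * (ε * ρ (i y) / 4))) := by
            congr 3; field_simp
        _ = ENNReal.ofReal (4 ^ n * ε ^ n) * volume (closedBall y.1 (ε * ρ (i y) / 4)) := by
            rw [volume_cube_mul _ y.1 (by positivity) (by positivity), ← mul_assoc,
              ← ENNReal.ofReal_mul hl.le, hεn]
            congr 2
            rw [div_pow]
            field_simp
    have hcovE : V \ E ⊆ ⋃ y ∈ u, closedBall y.1 (ε * ρ (i y)) \ E := by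
      intro y hy
      obtain ⟨b, hb, hsubb⟩ := hcov ⟨y, hy⟩ (mem_univ _)
      have h1 := hρ _ (his ⟨y, hy⟩)
      have hyb := hsubb (mem_closedBall_self (by positivity))
      refine mem_biUnion hb ⟨?_, hy.2⟩
      convert hyb using 1
      ring_nf
    calc volume (V \ E) ≤ _ := measure_mono hcovE
      _ ≤ ∑' y : u, volume (closedBall y.1.1 (ε * ρ (i y)) \ E) := measure_biUnion_le _ huc _
      _ ≤ ∑' y : u, ENNReal.ofReal (4 ^ n * ε ^ n) *
          volume (closedBall y.1.1 (ε * ρ (i y) / 4)) := ENNReal.tsum_le_tsum fun y => hone y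
      _ = ENNReal.ofReal (4 ^ n * ε ^ n) *
          volume (⋃ y ∈ u, closedBall y.1 (ε * ρ (i y) / 4)) := by
        rw [ENNReal.tsum_mul_left,
          measure_biUnion huc hud fun y _ => isClosed_closedBall.measurableSet]
      _ ≤ _ := by
        gcongr
        · exact pow_le_of_le_one hε0.le hε1.le (by omega)
        · refine iUnion₂_subset fun y _ => ?_
          have h1 := hρ _ (his y)
          exact (closedBall_subset_closedBall (by
            have : 0 < ε * ρ (i y) := by positivity
            linarith)).trans ((hball y).trans (hsub _ (his y)))
  calc volume (U \ E) ≤ volume ((U \ V) ∪ (V \ E)) := measure_mono fun y hy => by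
        by_cases hyV : y ∈ V
        · exact Or.inr ⟨hyV, hy.2⟩
        · exact Or.inl ⟨hy.1, hyV⟩
    _ ≤ _ := measure_union_le _ _
    _ ≤ _ := add_le_add hUV hVE
    _ = _ := by
      rw [← add_mul, ← ENNReal.ofReal_add (by positivity) (by positivity), ← add_mul]

end Solyanik

/-! ### Direct estimates for the Tauberian constant. -/

section Tauberian

variable {n : ℕ}

theorem volume_diff_le_of_lt {E B : Set (Fin n → ℝ)} (hE : MeasurableSet E) (hB : MeasurableSet B)
    (hBt : volume B ≠ ∞) {α : ℝ} (hα0 : 0 ≤ α) (h : ENNReal.ofReal α * volume B ≤ volume.restrict E B) :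
    volume (B \ E) ≤ ENNReal.ofReal (1 - α) * volume B := by
  rw [Measure.restrict_apply hB] at h
  have h1 : volume (B \ E) + volume (B ∩ E) = volume B := by
    rw [add_comm]; exact measure_inter_add_sdiff B hE
  rw [ENNReal.ofReal_sub _ hα0, ENNReal.ofReal_one, ENNReal.sub_mul (by simp [hBt]), one_mul]
  exact ENNReal.le_sub_of_add_le_left (ne_top_of_le_ne_top hBt (h.trans (measure_mono inter_subset_left)))
    ((add_le_add_left h _).trans (by rw [add_comm, h1]))

/-- The part of a superlevel set of the maximal function that lies outside `E` can be estimated by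
means of finite families of cubes. -/
theorem measure_lt_cubeMax_le (μ : Measure (Fin n → ℝ)) [IsLocallyFiniteMeasure μ]
    {E : Set (Fin n → ℝ)} (hE : MeasurableSet E) {α : ℝ} (hα0 : 0 ≤ α) {c : ℝ≥0∞}
    (h : ∀ s : Finset ((Fin n → ℝ) × ℝ), (∀ i ∈ s, 0 < i.2) →
      (∀ i ∈ s, volume (closedBall i.1 i.2 \ E) ≤
        ENNReal.ofReal (1 - α) * volume (closedBall i.1 i.2)) →
      μ ((⋃ i ∈ s, closedBall i.1 i.2) \ E) ≤ c) :
    μ {x | ENNReal.ofReal α < cubeMax (volume.restrict E) x} ≤ μ E + c := by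
  -- The superlevel set is open, so inner regularity and a finite subcover by open cubes suffice.
  rw [(isOpen_lt_cubeMax _ _).measure_eq_iSup_isCompact]
  refine iSup₂_le fun K hK => iSup_le fun hKc => ?_
  set ι := {i : (Fin n → ℝ) × ℝ // 0 < i.2 ∧
    ENNReal.ofReal α * volume (closedBall i.1 i.2) < volume.restrict E (closedBall i.1 i.2)}
  obtain ⟨t, ht⟩ := hKc.elim_finite_subcover (fun i : ι => ball i.1.1 i.1.2) (fun i => isOpen_ball)
    (fun y hy => by
      obtain ⟨z, r, hr, hyz, hlt⟩ := (lt_cubeMax_iff_ball ENNReal.ofReal_ne_top).1 (hK hy)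
      exact mem_iUnion.2 ⟨⟨(z, r), hr, hlt⟩, hyz⟩)
  classical
  have h1 := h (t.image Subtype.val)
    (fun i hi => by
      obtain ⟨j, -, rfl⟩ := Finset.mem_image.1 hi
      exact j.2.1)
    (fun i hi => by
      obtain ⟨j, -, rfl⟩ := Finset.mem_image.1 hi
      exact volume_diff_le_of_lt hE isClosed_closedBall.measurableSet (volume_cube_ne_top _ _) hα0
        j.2.2.le)
  calc μ K ≤ μ (E ∪ ((⋃ i ∈ t.image Subtype.val, closedBall i.1 i.2) \ E)) :=
        measure_mono fun y hy => by
          by_cases hyE : y ∈ E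
          · exact Or.inl hyE
          · obtain ⟨i, hi, hyi⟩ := mem_iUnion₂.1 (ht hy)
            exact Or.inr ⟨mem_iUnion₂.2 ⟨i.1, Finset.mem_image_of_mem _ hi,
              ball_subset_closedBall hyi⟩, hyE⟩
    _ ≤ _ := (measure_union_le _ _).trans (by gcongr)

/-- The part of the cube outside `E` has at most half of its mass. Sums over cubes can therefore be
charged to `E`, which makes the final bound proportional to `μ E`. -/
theorem IsHalving.measure_cube_le {μ : Measure (Fin n → ℝ)} [IsLocallyFiniteMeasure μ]
    (hμ : μ ≪ volume) {δ : ℝ} (hδ : 0 < δ) (hδ1 : δ ≤ 1 / 2) (h : IsHalving μ δ) {l : ℝ}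
    (hl : 0 < l) (hl2 : 3 * l ^ (decayExponent n δ / 2) ≤ 1 / 2) {z : Fin n → ℝ} {r : ℝ}
    (hr : 0 < r) {E : Set (Fin n → ℝ)} (hE : MeasurableSet E)
    (hB : volume (closedBall z r \ E) ≤ ENNReal.ofReal l * volume (closedBall z r)) :
    μ (closedBall z r) ≤ 2 * μ (closedBall z r ∩ E) := by
  have h1 := h.measure_le hμ hδ hδ1 hl hr sdiff_subset
    (isClosed_closedBall.measurableSet.diff hE) hB
  refine le_two_mul_of_le_half_add measure_closedBall_lt_top.ne ?_
  rw [add_comm]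
  nth_rw 1 [← measure_inter_add_sdiff (closedBall z r) hE]
  gcongr
  refine h1.trans ?_
  gcongr
  rw [← ENNReal.ofReal_ofNat 2, ← ENNReal.ofReal_inv_of_pos two_pos]
  exact ENNReal.ofReal_le_ofReal (by rw [inv_eq_one_div]; exact hl2)

/-- The weighted Solyanik estimate for a doubling measure. -/
theorem IsHalving.tauberian (hn : 1 ≤ n) {μ : Measure (Fin n → ℝ)} [IsLocallyFiniteMeasure μ]
    (hμ : μ ≪ volume) {δ : ℝ} (hδ : 0 < δ) (hδ1 : δ ≤ 1 / 2) (h : IsHalving μ δ) {D : ℝ≥0∞}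
    (hD : ∀ (z : Fin n → ℝ) (r : ℝ), 0 < r → μ (closedBall z (2 * r)) ≤ D * μ (closedBall z r))
    {α : ℝ} (hα0 : 0 ≤ α) (hα1 : α < 1)
    (hl2 : 3 * (1 - α) ^ (decayExponent n δ / 2) ≤ 1 / 2)
    {E : Set (Fin n → ℝ)} (hE : MeasurableSet E) :
    μ {x | ENNReal.ofReal α < cubeMax (volume.restrict E) x} ≤
      (1 + ENNReal.ofReal (6 * (n + 4 ^ n)) * D ^ 2 *
        ENNReal.ofReal ((1 - α) ^ (decayExponent n δ / (4 * n)))) * μ E := by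
  classical
  have hl : 0 < 1 - α := sub_pos.2 hα1
  set θ := decayExponent n δ with hθ
  have hθ0 : 0 < θ := decayExponent_pos n hδ hδ1
  have hθ1 : θ ≤ 1 := decayExponent_le_one n hδ hδ1
  have hn0 : (0 : ℝ) < n := by positivity
  set C : ℝ := n + 4 ^ n with hC
  have hC1 : 1 ≤ C := by
    have : (1 : ℝ) ≤ 4 ^ n := one_le_pow₀ (by norm_num)
    linarith
  set η : ℝ := 3 * C * (1 - α) ^ (θ / (4 * n)) with hη
  rw [add_mul, one_mul]
  refine measure_lt_cubeMax_le μ hE hα0 fun s hs0 hs => ?_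
  obtain ⟨M, hM⟩ := (s.image Prod.snd).exists_le
  obtain ⟨u, hus, huc, hud, hcov⟩ := exists_vitali_subfamily (s : Set ((Fin n → ℝ) × ℝ))
    Prod.fst Prod.snd (R := M) hs0 (fun i hi => hM _ (Finset.mem_image_of_mem _ hi))
  -- All cubes assigned to `b` lie in its fourfold dilate, where the Lebesgue estimate and the power
  -- bound apply; two doublings return to `b`, whose mass is charged to `b ∩ E`.
  have hloc : ∀ b ∈ u, μ ((⋃ i ∈ s.filter fun i => closedBall i.1 i.2 ⊆ closedBall b.1 (4 * b.2),
      closedBall i.1 i.2) \ E) ≤ ENNReal.ofReal η * D ^ 2 * (2 * μ (closedBall b.1 b.2 ∩ E)) := by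
    intro b hb
    have hb0 : 0 < b.2 := hs0 b (hus hb)
    have hv := volume_biUnion_diff_le hn (s.filter fun i => closedBall i.1 i.2 ⊆
      closedBall b.1 (4 * b.2)) Prod.fst Prod.snd (fun i hi => hs0 i (Finset.mem_filter.1 hi).1)
      (fun i hi => (Finset.mem_filter.1 hi).2) E hl (by linarith)
      (fun i hi => hs i (Finset.mem_filter.1 hi).1)
    have hm : MeasurableSet (⋃ i ∈ s.filter fun i => closedBall i.1 i.2 ⊆
        closedBall b.1 (4 * b.2), closedBall i.1 i.2) :=
      Finset.measurableSet_biUnion _ fun i _ => isClosed_closedBall.measurableSet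
    have hss : (⋃ i ∈ s.filter fun i => closedBall i.1 i.2 ⊆
        closedBall b.1 (4 * b.2), closedBall i.1 i.2) ⊆ closedBall b.1 (4 * b.2) :=
      iUnion₂_subset fun i hi => (Finset.mem_filter.1 hi).2
    have hl' : 0 < (n + 4 ^ n) * (1 - α) ^ (1 / (2 * n : ℝ)) := by positivity
    have h1 := h.measure_le hμ hδ hδ1 hl' (by positivity : 0 < 4 * b.2)
      (sdiff_subset.trans hss) (hm.diff hE) hv
    refine (h1.trans (mul_le_mul' ?_ ?_)).trans_eq (mul_assoc _ _ _).symm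
    · apply ENNReal.ofReal_le_ofReal
      rw [hη, mul_assoc]
      gcongr
      rw [Real.mul_rpow (by positivity) (by positivity), ← Real.rpow_mul hl.le]
      -- The Solyanik exponent `1/(2n)` composed with the transfer exponent `θ/2`.
      have e : 1 / (2 * (n : ℝ)) * (θ / 2) = θ / (4 * n) := by field_simp; norm_num
      rw [e]
      gcongr
      calc C ^ (θ / 2) ≤ C ^ (1 : ℝ) := Real.rpow_le_rpow_of_exponent_le hC1 (by linarith)
        _ = C := Real.rpow_one C
    · calc μ (closedBall b.1 (4 * b.2)) = μ (closedBall b.1 (2 * (2 * b.2))) := by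
            congr 2; ring
        _ ≤ D * (D * μ (closedBall b.1 b.2)) :=
            (hD _ _ (by positivity)).trans (by gcongr; exact hD _ _ hb0)
        _ = D ^ 2 * μ (closedBall b.1 b.2) := by ring
        _ ≤ _ := by
            gcongr
            exact h.measure_cube_le hμ hδ hδ1 hl hl2 hb0 hE (hs b (hus hb))
  have hsub : (⋃ i ∈ s, closedBall i.1 i.2) \ E ⊆
      ⋃ b ∈ u, (⋃ i ∈ s.filter fun i => closedBall i.1 i.2 ⊆ closedBall b.1 (4 * b.2),
        closedBall i.1 i.2) \ E := by
    rintro y ⟨hy, hyE⟩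
    obtain ⟨i, hi, hyi⟩ := mem_iUnion₂.1 hy
    obtain ⟨b, hb, hib⟩ := hcov i hi
    exact mem_biUnion hb ⟨mem_biUnion (Finset.mem_coe.2 (Finset.mem_filter.2 ⟨hi, hib⟩)) hyi, hyE⟩
  calc _ ≤ _ := measure_mono hsub
    _ ≤ ∑' b : u, _ := measure_biUnion_le _ huc _
    _ ≤ ∑' b : u, ENNReal.ofReal η * D ^ 2 * (2 * μ (closedBall b.1.1 b.1.2 ∩ E)) :=
      ENNReal.tsum_le_tsum fun b => hloc b b.2
    _ = ENNReal.ofReal η * D ^ 2 * (2 * μ (⋃ b ∈ u, closedBall b.1 b.2 ∩ E)) := by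
      rw [ENNReal.tsum_mul_left, ENNReal.tsum_mul_left, measure_biUnion huc
        (hud.mono fun b => inter_subset_left)
        fun b _ => isClosed_closedBall.measurableSet.inter hE]
    _ ≤ ENNReal.ofReal η * D ^ 2 * (2 * μ E) := by
      gcongr
      exact iUnion₂_subset fun b _ => inter_subset_right
    _ = _ := by
      have e : ENNReal.ofReal (6 * C) * ENNReal.ofReal ((1 - α) ^ (θ / (4 * n))) =
          2 * ENNReal.ofReal η := by
        rw [← ENNReal.ofReal_mul (by positivity), ← ENNReal.ofReal_ofNat 2,
          ← ENNReal.ofReal_mul zero_le_two, hη]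
        congr 1; ring
      calc _ = 2 * ENNReal.ofReal η * D ^ 2 * μ E := by ring
        _ = _ := by rw [← e]; ring

/-- A finite family of intervals has a subfamily with the same union in which every point is
covered at most twice. -/
theorem exists_subfamily_overlap_le_two (s : Finset ((Fin 1 → ℝ) × ℝ)) :
    ∃ s' ⊆ s, (⋃ i ∈ s', closedBall i.1 i.2) = ⋃ i ∈ s, closedBall i.1 i.2 ∧
      ∀ y, ∑ i ∈ s', (closedBall i.1 i.2).indicator (fun _ => (1 : ℝ≥0∞)) y ≤ 2 := by
  classical
  -- Take a subfamily of least cardinality with the same union. Among three intervals through `y`,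
  -- one is covered by those reaching furthest left and right, contradicting minimality.
  obtain ⟨s', hs', hmin⟩ := (s.powerset.filter fun t =>
    (⋃ i ∈ t, closedBall i.1 i.2) = ⋃ i ∈ s, closedBall i.1 i.2).exists_min_image Finset.card
      ⟨s, by simp⟩
  simp only [Finset.mem_filter, Finset.mem_powerset] at hs' hmin
  refine ⟨s', hs'.1, hs'.2, fun y => ?_⟩
  by_contra! hlt
  set T := s'.filter fun i => y ∈ closedBall i.1 i.2 with hT
  have hcard : 2 < T.card := by
    have e : ∑ i ∈ s', (closedBall i.1 i.2).indicator (fun _ => (1 : ℝ≥0∞)) y = T.card := by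
      simp [Set.indicator_apply, hT]
    rw [e] at hlt
    exact_mod_cast hlt
  have hTne : T.Nonempty := Finset.card_pos.1 (by omega)
  obtain ⟨i, hi, himin⟩ := T.exists_min_image (fun i => i.1 0 - i.2) hTne
  obtain ⟨j, hj, hjmax⟩ := T.exists_max_image (fun i => i.1 0 + i.2) hTne
  obtain ⟨k, hk, hkij⟩ : ∃ k ∈ T, k ∉ ({i, j} : Finset _) :=
    Finset.exists_mem_notMem_of_card_lt_card (Finset.card_le_two.trans_lt hcard)
  simp only [Finset.mem_insert, Finset.mem_singleton, not_or] at hkij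
  have hmem : ∀ (a v : Fin 1 → ℝ) (ρ : ℝ), v ∈ closedBall a ρ ↔ a 0 - ρ ≤ v 0 ∧ v 0 ≤ a 0 + ρ := by
    intro a v ρ
    have : dist v a = dist (v 0) (a 0) := by simp [dist_pi_def]
    rw [mem_closedBall, this, Real.dist_eq, abs_le]
    constructor <;> rintro ⟨h1, h2⟩ <;> constructor <;> linarith
  have hsub : closedBall k.1 k.2 ⊆ closedBall i.1 i.2 ∪ closedBall j.1 j.2 := by
    intro v hv
    have h1 := himin k hk
    have h2 := hjmax k hk
    have hyi := (hmem _ _ _).1 (Finset.mem_filter.1 hi).2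
    have hyj := (hmem _ _ _).1 (Finset.mem_filter.1 hj).2
    rw [hmem] at hv
    rw [mem_union, hmem, hmem]
    rcases le_total (v 0) (y 0) with h | h
    · left; constructor <;> linarith
    · right; constructor <;> linarith
  have hkT := (Finset.mem_filter.1 hk).1
  have hcon := hmin (s'.erase k) ⟨(Finset.erase_subset _ _).trans hs'.1, by
    rw [← hs'.2]
    refine subset_antisymm (biUnion_subset_biUnion_left fun a ha => Finset.mem_of_mem_erase ha) ?_
    refine iUnion₂_subset fun a ha v hv => ?_
    rcases eq_or_ne a k with rfl | hak
    · rcases hsub hv with h | h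
      · exact mem_biUnion (Finset.mem_coe.2 (Finset.mem_erase.2
          ⟨Ne.symm hkij.1, (Finset.mem_filter.1 hi).1⟩)) h
      · exact mem_biUnion (Finset.mem_coe.2 (Finset.mem_erase.2
          ⟨Ne.symm hkij.2, (Finset.mem_filter.1 hj).1⟩)) h
    · exact mem_biUnion (Finset.mem_coe.2 (Finset.mem_erase.2 ⟨hak, ha⟩)) hv⟩
  exact absurd (Finset.card_erase_lt_of_mem hkT) (not_lt.2 hcon)

/-- The weighted Solyanik estimate on the line; no doubling constant is needed. -/
theorem IsHalving.tauberian_one {μ : Measure (Fin 1 → ℝ)} [IsLocallyFiniteMeasure μ]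
    (hμ : μ ≪ volume) {δ : ℝ} (hδ : 0 < δ) (hδ1 : δ ≤ 1 / 2) (h : IsHalving μ δ)
    {α : ℝ} (hα0 : 0 ≤ α) (hα1 : α < 1)
    (hl2 : 3 * (1 - α) ^ (decayExponent 1 δ / 2) ≤ 1 / 2)
    {E : Set (Fin 1 → ℝ)} (hE : MeasurableSet E) :
    μ {x | ENNReal.ofReal α < cubeMax (volume.restrict E) x} ≤
      (1 + ENNReal.ofReal 12 * ENNReal.ofReal ((1 - α) ^ (decayExponent 1 δ / 2))) * μ E := by
  have hl : 0 < 1 - α := sub_pos.2 hα1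
  rw [add_mul, one_mul]
  refine measure_lt_cubeMax_le μ hE hα0 fun s hs0 hs => ?_
  obtain ⟨s', hs', hU, hover⟩ := exists_subfamily_overlap_le_two s
  set η : ℝ≥0∞ := ENNReal.ofReal (3 * (1 - α) ^ (decayExponent 1 δ / 2)) with hη
  rw [← hU]
  -- Bounded overlap replaces disjointness, so each interval is estimated at its own scale, without
  -- dilation.
  have hsum : ∑ i ∈ s', μ (closedBall i.1 i.2 ∩ E) ≤ 2 * μ E := by
    calc ∑ i ∈ s', μ (closedBall i.1 i.2 ∩ E)
        = ∑ i ∈ s', ∫⁻ y in E, (closedBall i.1 i.2).indicator (fun _ => (1 : ℝ≥0∞)) y ∂μ := by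
          refine Finset.sum_congr rfl fun i _ => ?_
          rw [lintegral_indicator isClosed_closedBall.measurableSet, setLIntegral_one,
            Measure.restrict_apply isClosed_closedBall.measurableSet]
      _ = ∫⁻ y in E, ∑ i ∈ s', (closedBall i.1 i.2).indicator (fun _ => (1 : ℝ≥0∞)) y ∂μ := by
          rw [lintegral_finsetSum]
          exact fun i _ => measurable_const.indicator isClosed_closedBall.measurableSet
      _ ≤ ∫⁻ _ in E, 2 ∂μ := lintegral_mono hover
      _ = 2 * μ E := by simp
  calc μ ((⋃ i ∈ s', closedBall i.1 i.2) \ E) = μ (⋃ i ∈ s', closedBall i.1 i.2 \ E) := by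
        congr 1; simp only [iUnion_sdiff]
    _ ≤ ∑ i ∈ s', μ (closedBall i.1 i.2 \ E) := measure_biUnion_finset_le _ _
    _ ≤ ∑ i ∈ s', η * (2 * μ (closedBall i.1 i.2 ∩ E)) := by
        refine Finset.sum_le_sum fun i hi => ?_
        have hi0 := hs0 i (hs' hi)
        refine (h.measure_le hμ hδ hδ1 hl hi0 sdiff_subset
          (isClosed_closedBall.measurableSet.diff hE) (hs i (hs' hi))).trans ?_
        gcongr
        exact h.measure_cube_le hμ hδ hδ1 hl hl2 hi0 hE (hs i (hs' hi))
    _ = η * (2 * ∑ i ∈ s', μ (closedBall i.1 i.2 ∩ E)) := by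
        rw [Finset.mul_sum, Finset.mul_sum]
    _ ≤ η * (2 * (2 * μ E)) := by gcongr
    _ = _ := by
        have e : ENNReal.ofReal 12 * ENNReal.ofReal ((1 - α) ^ (decayExponent 1 δ / 2)) = 4 * η := by
          rw [← ENNReal.ofReal_mul (by norm_num), hη, ← ENNReal.ofReal_ofNat 4,
            ← ENNReal.ofReal_mul (by norm_num)]
          congr 1; ring
        rw [e]; ring

end Tauberian

/-! ### From the Tauberian constant through halving to the Fujii–Wilson constant. -/

section Converse

variable {n : ℕ}

/-- The weak type `(1, 1)` inequality for the uncentered maximal function of a measure. -/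
theorem mul_volume_lt_cubeMax_le (ν : Measure (Fin n → ℝ)) {t : ℝ≥0∞} (ht : t ≠ ∞) :
    t * volume {x | t < cubeMax ν x} ≤ 4 ^ n * ν univ := by
  classical
  rw [(isOpen_lt_cubeMax _ _).measure_eq_iSup_isCompact]
  simp only [ENNReal.mul_iSup]
  refine iSup₂_le fun K hK => iSup_le fun hKc => ?_
  set ι := {i : (Fin n → ℝ) × ℝ // 0 < i.2 ∧
    t * volume (closedBall i.1 i.2) < ν (closedBall i.1 i.2)}
  obtain ⟨s, hs⟩ := hKc.elim_finite_subcover (fun i : ι => ball i.1.1 i.1.2) (fun i => isOpen_ball)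
    (fun y hy => by
      obtain ⟨z, r, hr, hyz, hlt⟩ := (lt_cubeMax_iff_ball ht).1 (hK hy)
      exact mem_iUnion.2 ⟨⟨(z, r), hr, hlt⟩, hyz⟩)
  obtain ⟨M, hM⟩ := (s.image fun i => i.1.2).exists_le
  obtain ⟨u, hus, huc, hud, hcov⟩ := exists_vitali_subfamily (s : Set ι)
    (fun i => i.1.1) (fun i => i.1.2) (R := M) (fun i _ => i.2.1)
    (fun i hi => hM _ (Finset.mem_image_of_mem (fun i : ι => i.1.2) hi))
  have hKu : K ⊆ ⋃ b ∈ u, closedBall b.1.1 (4 * b.1.2) := by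
    intro y hy
    obtain ⟨i, hi, hyi⟩ := mem_iUnion₂.1 (hs hy)
    obtain ⟨b, hb, hib⟩ := hcov i hi
    exact mem_biUnion hb (hib (ball_subset_closedBall hyi))
  calc t * volume K ≤ t * ∑' b : u, volume (closedBall b.1.1.1 (4 * b.1.1.2)) := by
        gcongr
        exact (measure_mono hKu).trans (measure_biUnion_le _ huc _)
    _ = ∑' b : u, 4 ^ n * (t * volume (closedBall b.1.1.1 b.1.1.2)) := by
        rw [← ENNReal.tsum_mul_left]
        refine tsum_congr fun b => ?_
        rw [volume_cube_mul _ b.1.1.1 b.1.2.1.le (by norm_num), ENNReal.ofReal_pow (by norm_num),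
          ENNReal.ofReal_ofNat]
        ring
    _ ≤ ∑' b : u, 4 ^ n * ν (closedBall b.1.1.1 b.1.1.2) :=
        ENNReal.tsum_le_tsum fun b => by gcongr; exact b.1.2.2.le
    _ = 4 ^ n * ν (⋃ b ∈ u, closedBall b.1.1 b.1.2) := by
        rw [ENNReal.tsum_mul_left,
          measure_biUnion huc hud fun b _ => isClosed_closedBall.measurableSet]
    _ ≤ _ := by gcongr; exact subset_univ _

/-- The part of the density below `t` contributes at most `t` to any average. An average above `2t`
thus forces the part above `t` to average more than `t`, and the weak type inequality applies to
that part alone. -/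
theorem mul_volume_lt_cubeMax_restrict_le {μ : Measure (Fin n → ℝ)} [IsLocallyFiniteMeasure μ]
    (hμ : μ ≪ volume) {B : Set (Fin n → ℝ)} {t : ℝ≥0∞} (ht : t ≠ ∞) :
    t * volume {x | 2 * t < cubeMax (μ.restrict B) x} ≤
      4 ^ n * μ (B ∩ {x | t < μ.rnDeriv volume x}) := by
  set G := B ∩ {x | t < μ.rnDeriv volume x} with hG
  refine le_trans ?_ ((mul_volume_lt_cubeMax_le (μ.restrict G) ht).trans_eq
    (by rw [Measure.restrict_apply_univ]))
  refine mul_le_mul' le_rfl (measure_mono fun x hx => ?_)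
  obtain ⟨z, r, hr, hxz, hlt⟩ := lt_cubeMax_iff.1 hx
  refine lt_cubeMax_iff.2 ⟨z, r, hr, hxz, ?_⟩
  have hQ : MeasurableSet (closedBall z r) := isClosed_closedBall.measurableSet
  rw [Measure.restrict_apply hQ] at hlt ⊢
  have h1 : μ (closedBall z r ∩ B) ≤ μ (closedBall z r ∩ G) + t * volume (closedBall z r) := by
    calc μ (closedBall z r ∩ B) ≤ μ ((closedBall z r ∩ G) ∪
          (closedBall z r ∩ {x | μ.rnDeriv volume x ≤ t})) := measure_mono fun y hy => by
            rcases lt_or_ge t (μ.rnDeriv volume y) with h | h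
            · exact Or.inl ⟨hy.1, hy.2, h⟩
            · exact Or.inr ⟨hy.1, h⟩
      _ ≤ _ := (measure_union_le _ _).trans (by gcongr; exact measure_inter_rnDeriv_le μ hμ hQ t)
  rw [two_mul, add_mul] at hlt
  exact (ENNReal.add_lt_add_iff_right (ENNReal.mul_ne_top ht (volume_cube_ne_top z r))).1
    (hlt.trans_le h1)

theorem lintegral_Ioi_two_rpow {θ : ℝ} (hθ : 0 < θ) :
    ∫⁻ s in Ioi (2 : ℝ), ENNReal.ofReal ((s / 2) ^ (-1 - θ)) = ENNReal.ofReal (2 / θ) := by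
  have hlt : -1 - θ < -1 := by linarith
  have e : ∀ s ∈ Ioi (2 : ℝ), ENNReal.ofReal ((s / 2) ^ (-1 - θ)) =
      ENNReal.ofReal (2 ^ (1 + θ)) * ENNReal.ofReal (s ^ (-1 - θ)) := by
    intro s hs
    have hs0 : (0 : ℝ) < s := two_pos.trans hs
    rw [← ENNReal.ofReal_mul (by positivity), Real.div_rpow hs0.le zero_le_two,
      show (-1 - θ) = -(1 + θ) by ring, Real.rpow_neg zero_le_two, div_inv_eq_mul, mul_comm]
  rw [setLIntegral_congr_fun measurableSet_Ioi e, lintegral_const_mul' _ _ ENNReal.ofReal_ne_top,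
    ← ofReal_integral_eq_lintegral_ofReal (integrableOn_Ioi_rpow_of_lt hlt two_pos),
    integral_Ioi_rpow_of_lt hlt two_pos, ← ENNReal.ofReal_mul (by positivity)]
  · congr 1
    rw [show -1 - θ + 1 = -θ by ring, Real.rpow_add two_pos, Real.rpow_one, Real.rpow_neg zero_le_two]
    have : (2 : ℝ) ^ θ ≠ 0 := by positivity
    field_simp
  · filter_upwards [ae_restrict_mem measurableSet_Ioi] with s hs
    exact Real.rpow_nonneg (two_pos.trans hs).le _

/-- Layer cake in units of the average of `μ`. Heights `s ≤ 2` are bounded trivially and give the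
summand `2`; above, the truncated weak type inequality and the power decay give an integrand of
order `s^(-1-θ)`, whose integral produces `1/θ`. -/
theorem IsHalving.lintegral_cubeMax_le {μ : Measure (Fin n → ℝ)} [IsLocallyFiniteMeasure μ]
    (hμ : μ ≪ volume) {δ : ℝ} (hδ : 0 < δ) (hδ1 : δ ≤ 1 / 2) (h : IsHalving μ δ)
    (z : Fin n → ℝ) {r : ℝ} (hr : 0 < r) :
    ∫⁻ x in closedBall z r, cubeMax (μ.restrict (closedBall z r)) x ≤
      ENNReal.ofReal (2 + 4 ^ (n + 1) / decayExponent n δ) * μ (closedBall z r) := by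
  set B := closedBall z r with hB
  set θ := decayExponent n δ with hθ
  have hθ0 : 0 < θ := decayExponent_pos n hδ hδ1
  have hv0 : volume B ≠ 0 := volume_cube_ne_zero z hr
  have hvt : volume B ≠ ∞ := volume_cube_ne_top z r
  have hBt : μ B ≠ ∞ := measure_closedBall_lt_top.ne
  set M := cubeMax (μ.restrict B) with hM
  have hMm : Measurable M := measurable_cubeMax _
  rcases eq_or_ne (μ B) 0 with hB0 | hB0
  · have : M = 0 := by
      funext x
      rw [hM, Measure.restrict_eq_zero.2 hB0]
      simp [cubeMax]
    rw [this]; simp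
  set A := μ B / volume B with hA
  have hA0 : A ≠ 0 := (ENNReal.div_pos hB0 hvt).ne'
  have hAt : A ≠ ∞ := ENNReal.div_ne_top hBt hv0
  have hAB : A * volume B = μ B := ENNReal.div_mul_cancel hv0 hvt
  have key : ∀ s ∈ Ioi (2 : ℝ), A * (volume.restrict B) {x | ENNReal.ofReal s < M x / A} ≤
      4 ^ n * 2 * μ B * ENNReal.ofReal ((s / 2) ^ (-1 - θ)) := by
    intro s hs
    have hs2 : (2 : ℝ) < s := hs
    set v : ℝ := s / 2 with hv
    have hv1 : 1 ≤ v := by rw [hv]; linarith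
    have hv00 : 0 < v := one_pos.trans_le hv1
    have e : {x | ENNReal.ofReal s < M x / A} = {x | 2 * (ENNReal.ofReal v * A) < M x} := by
      ext x
      simp only [mem_ofPred_eq]
      rw [ENNReal.lt_div_iff_mul_lt (Or.inl hA0) (Or.inl hAt), ← mul_assoc,
        ← ENNReal.ofReal_ofNat 2, ← ENNReal.ofReal_mul zero_le_two, hv, mul_div_cancel₀ _ two_ne_zero]
    have h1 := (mul_volume_lt_cubeMax_restrict_le hμ (B := B) (t := ENNReal.ofReal v * A)
      (ENNReal.mul_ne_top ENNReal.ofReal_ne_top hAt)).trans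
      (mul_le_mul_right (h.rnDeriv_decay hμ hδ hδ1 hv1 z hr) _)
    rw [e]
    calc A * (volume.restrict B) {x | 2 * (ENNReal.ofReal v * A) < M x}
        ≤ A * volume {x | 2 * (ENNReal.ofReal v * A) < M x} := by
          gcongr; exact Measure.restrict_le_self
      _ = ENNReal.ofReal v⁻¹ * (ENNReal.ofReal v * A *
          volume {x | 2 * (ENNReal.ofReal v * A) < M x}) := by
          rw [mul_assoc (ENNReal.ofReal v), ← mul_assoc (ENNReal.ofReal v⁻¹),
            ← ENNReal.ofReal_mul (inv_nonneg.2 hv00.le), inv_mul_cancel₀ hv00.ne',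
            ENNReal.ofReal_one, one_mul]
      _ ≤ ENNReal.ofReal v⁻¹ * (4 ^ n * (ENNReal.ofReal (2 * v ^ (-θ)) * μ B)) := by gcongr
      _ = 4 ^ n * 2 * μ B * (ENNReal.ofReal v⁻¹ * ENNReal.ofReal (v ^ (-θ))) := by
          rw [ENNReal.ofReal_mul zero_le_two, ENNReal.ofReal_ofNat]; ring
      _ = _ := by
          rw [← ENNReal.ofReal_mul (inv_nonneg.2 hv00.le), ← Real.rpow_neg_one,
            ← Real.rpow_add hv00, sub_eq_add_neg]
  have hsplit : Ioi (0 : ℝ) = Ioc 0 2 ∪ Ioi 2 := (Ioc_union_Ioi_eq_Ioi zero_le_two).symm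
  calc ∫⁻ x in B, M x = A * ∫⁻ x in B, M x / A := by
        simp only [div_eq_mul_inv]
        rw [lintegral_mul_const _ hMm, mul_left_comm A, ENNReal.mul_inv_cancel hA0 hAt, mul_one]
    _ = ∫⁻ s in Ioi (0 : ℝ), A * (volume.restrict B) {x | ENNReal.ofReal s < M x / A} := by
        rw [lintegral_eq_lintegral_Ioi_meas_lt _ (hMm.div_const A), lintegral_const_mul' _ _ hAt]
    _ ≤ (∫⁻ s in Ioc (0 : ℝ) 2, A * (volume.restrict B) {x | ENNReal.ofReal s < M x / A}) +
        ∫⁻ s in Ioi (2 : ℝ), A * (volume.restrict B) {x | ENNReal.ofReal s < M x / A} := by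
        rw [hsplit]; exact lintegral_union_le _ _ _
    _ ≤ (∫⁻ _ in Ioc (0 : ℝ) 2, μ B) +
        ∫⁻ s in Ioi (2 : ℝ), 4 ^ n * 2 * μ B * ENNReal.ofReal ((s / 2) ^ (-1 - θ)) := by
        refine add_le_add (lintegral_mono fun s => ?_) (setLIntegral_mono' measurableSet_Ioi key)
        rw [← hAB]
        exact mul_le_mul' le_rfl
          ((measure_mono (subset_univ _)).trans_eq (Measure.restrict_apply_univ B))
    _ = 2 * μ B + 4 ^ n * 2 * μ B * ENNReal.ofReal (2 / θ) := by
        rw [lintegral_const_mul' _ _ (ENNReal.mul_ne_top (by finiteness) hBt),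
          lintegral_Ioi_two_rpow hθ0, setLIntegral_const, Real.volume_Ioc, mul_comm (μ B)]
        simp
    _ = _ := by
        have e : (4 : ℝ) ^ (n + 1) / θ = 4 ^ n * 2 * (2 / θ) := by ring
        rw [ENNReal.ofReal_add zero_le_two (by positivity), e, ENNReal.ofReal_mul (by positivity),
          ENNReal.ofReal_mul (by positivity), ENNReal.ofReal_pow (by norm_num),
          ENNReal.ofReal_ofNat, ENNReal.ofReal_ofNat]
        ring

/-- If `|F| ≤ (1-α)/2 |Q|`, then `Q \ F` fills more than the fraction `α` of `Q`, so `Q` lies in the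
superlevel set for `E = Q \ F`. Hence `μ Q ≤ (3/2) μ (Q \ F)`, and subtracting `μ (Q \ F)` leaves `μ
F ≤ μ (Q \ F) / 2`. -/
theorem isHalving_of_tauberian (hn : 1 ≤ n) {μ : Measure (Fin n → ℝ)} [IsLocallyFiniteMeasure μ]
    (hμ : μ ≪ volume) {α : ℝ} (hα0 : 0 < α) (hα1 : α < 1)
    (h : ∀ E : Set (Fin n → ℝ), MeasurableSet E → 0 < μ E → μ E < ∞ →
      μ {x | ENNReal.ofReal α < cubeMax (volume.restrict E) x} ≤ ENNReal.ofReal (3 / 2) * μ E) :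
    IsHalving μ ((1 - α) / 2) := by
  intro z r hr F hFB hF hFv
  set B := closedBall z r with hB
  have hBm : MeasurableSet B := isClosed_closedBall.measurableSet
  have hvt : volume B ≠ ∞ := volume_cube_ne_top z r
  have hBt : μ B ≠ ∞ := measure_closedBall_lt_top.ne
  have hsup : ∀ E, B \ F ⊆ E → B ⊆ {x | ENNReal.ofReal α < cubeMax (volume.restrict E) x} := by
    intro E hE x hx
    refine lt_cubeMax_iff.2 ⟨z, r, hr, hx, ?_⟩
    rw [Measure.restrict_apply hBm]
    refine lt_of_lt_of_le ?_ (measure_mono (subset_inter sdiff_subset hE))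
    rw [measure_sdiff hFB hF.nullMeasurableSet (ne_top_of_le_ne_top hvt (measure_mono hFB))]
    refine lt_of_lt_of_le ?_ (tsub_le_tsub_left hFv _)
    rw [lt_tsub_iff_right, ← add_mul, ← ENNReal.ofReal_add hα0.le (by linarith)]
    calc _ < 1 * volume B := by
          refine ENNReal.mul_lt_mul_left (volume_cube_ne_zero z hr) hvt ?_
          rw [ENNReal.ofReal_lt_one]; linarith
      _ = volume B := one_mul _
  have hEm : MeasurableSet (B \ F) := hBm.diff hF
  have hEt : μ (B \ F) ≠ ∞ := ne_top_of_le_ne_top hBt (measure_mono sdiff_subset)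
  have hadd : μ F + μ (B \ F) = μ B := by
    rw [← measure_inter_add_sdiff B hF, inter_eq_right.2 hFB]
  rcases eq_or_ne (μ (B \ F)) 0 with hE0 | hE0
  -- Here `E = Q \ F` is not admissible, having no mass. Adding the trace on `Q` of a small
  -- neighbourhood of a point charged by `μ` gives a set of positive mass below `μ Q / 2`, which
  -- still forces `μ Q ≤ (3/2) μ E`, a contradiction. Points are null because `n ≥ 1`.
  · suffices h0 : μ B = 0 by rw [measure_mono_null hFB h0]; exact zero_le
    by_contra hB0
    obtain ⟨x, hxB, hx⟩ := exists_mem_forall_mem_nhdsWithin_pos_measure hB0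
    have : Nonempty (Fin n) := ⟨⟨0, hn⟩⟩
    have hx0 : μ {x} = 0 := hμ (by simp)
    obtain ⟨U, hxU, hU, hUlt⟩ := ({x} : Set (Fin n → ℝ)).exists_isOpen_lt_of_lt (μ := μ) (μ B / 2)
      (by rw [hx0]; exact ENNReal.half_pos hB0)
    have hG0 : 0 < μ (B ∩ U) :=
      hx _ (inter_mem_nhdsWithin B (hU.mem_nhds (hxU (mem_singleton x))))
    have hle : μ (B \ F ∪ B ∩ U) ≤ μ (B ∩ U) :=
      (measure_union_le _ _).trans_eq (by rw [hE0, zero_add])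
    have h1 := h (B \ F ∪ B ∩ U) (hEm.union (hBm.inter hU.measurableSet))
      (hG0.trans_le (measure_mono subset_union_right))
      (hle.trans_lt ((measure_mono inter_subset_left).trans_lt hBt.lt_top))
    have h2 : μ B ≤ 2 * μ U := by
      calc μ B ≤ _ := measure_mono (hsup _ subset_union_left)
        _ ≤ _ := h1
        _ ≤ ENNReal.ofReal 2 * μ U := by
          exact mul_le_mul' (ENNReal.ofReal_le_ofReal (by norm_num))
            (hle.trans (measure_mono inter_subset_right))
        _ = _ := by rw [ENNReal.ofReal_ofNat]
    refine absurd h2 (not_le.2 ?_)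
    calc 2 * μ U < 2 * (μ B / 2) := ENNReal.mul_lt_mul_right two_ne_zero (by simp) hUlt
      _ = μ B := ENNReal.mul_div_cancel two_ne_zero (by simp)
  · have h1 := h (B \ F) hEm (pos_iff_ne_zero.2 hE0) hEt.lt_top
    have h2 : μ F + μ (B \ F) ≤ 2⁻¹ * μ (B \ F) + μ (B \ F) := by
      rw [hadd]
      refine (measure_mono (hsup _ subset_rfl)).trans (h1.trans_eq ?_)
      have e : ENNReal.ofReal (3 / 2) = 2⁻¹ + 1 := by
        rw [← ENNReal.ofReal_ofNat 2, ← ENNReal.ofReal_inv_of_pos two_pos, ← ENNReal.ofReal_one,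
          ← ENNReal.ofReal_add (by norm_num) zero_le_one]
        norm_num
      rw [e, add_mul, one_mul]
    exact ((ENNReal.add_le_add_iff_right hEt).1 h2).trans (by gcongr; exact sdiff_subset)

end Converse

/-! ### Translation to weights, with explicit constants. -/

section Weights

variable {n : ℕ} {w : (Fin n → ℝ) → ℝ}

theorem weightMeasure_absolutelyContinuous (w : (Fin n → ℝ) → ℝ) : weightMeasure w ≪ volume :=
  withDensity_absolutelyContinuous _ _

theorem IsWeight.isLocallyFiniteMeasure (hw : IsWeight w) :
    IsLocallyFiniteMeasure (weightMeasure w) := by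
  refine ⟨fun x => ?_⟩
  obtain ⟨U, hU, hint⟩ := hw.locallyIntegrable x
  refine ⟨U, hU, ?_⟩
  rw [weightMeasure, withDensity_apply']
  exact hint.lintegral_lt_top

theorem IsWeight.weightMeasure_ne_zero (hw : IsWeight w) : weightMeasure w ≠ 0 := by
  have hm : AEMeasurable (fun x => ENNReal.ofReal (w x)) volume :=
    hw.locallyIntegrable.aestronglyMeasurable.aemeasurable.ennreal_ofReal
  rw [weightMeasure, Ne, withDensity_eq_zero_iff hm]
  intro h
  refine hw.not_ae_zero ?_
  filter_upwards [h] with x hx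
  exact le_antisymm (ENNReal.ofReal_eq_zero.1 hx) (hw.nonneg x)

theorem IsWeight.exists_measure_cube_pos (hw : IsWeight w) :
    ∃ (z : Fin n → ℝ) (r : ℝ), 0 < r ∧ 0 < weightMeasure w (closedBall z r) := by
  by_contra! h
  apply hw.weightMeasure_ne_zero
  rw [← Measure.measure_univ_eq_zero]
  refine measure_mono_null (fun x _ => ?_) (measure_iUnion_null fun k : ℕ =>
    le_zero_iff.1 (h 0 (k + 1) (by positivity)))
  obtain ⟨k, hk⟩ := exists_nat_ge (dist x 0)
  exact mem_iUnion.2 ⟨k, (hk.trans (by linarith) : dist x 0 ≤ k + 1)⟩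

theorem lintegral_cube_maximalFn (hw : IsWeight w) (z : Fin n → ℝ) (r : ℝ) :
    ∫⁻ x in closedBall z r, maximalFn ((closedBall z r).indicator w) x =
      ∫⁻ x in closedBall z r, cubeMax ((weightMeasure w).restrict (closedBall z r)) x :=
  lintegral_congr fun x => maximalFn_indicator hw.nonneg isClosed_closedBall.measurableSet x

theorem lintegral_cubeMax_le_fujiiWilson (hw : MemAInfty w) (z : Fin n → ℝ) {r : ℝ} (hr : 0 < r) :
    ∫⁻ x in closedBall z r, cubeMax ((weightMeasure w).restrict (closedBall z r)) x ≤
      fujiiWilson w * weightMeasure w (closedBall z r) := by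
  have := hw.1.isLocallyFiniteMeasure
  have e : axisCube z (2 * r) = closedBall z r := by
    rw [axisCube_eq_closedBall z (by positivity)]; congr 1; ring
  rw [← lintegral_cube_maximalFn hw.1, ← e,
    ← ENNReal.div_le_iff_le_mul (Or.inr hw.2.ne) (Or.inl (by
      rw [e]; exact measure_closedBall_lt_top.ne))]
  exact le_iSup₂_of_le z (2 * r) (le_iSup_of_le (by positivity) le_rfl)

theorem fujiiWilson_le (hw : IsWeight w) {K : ℝ≥0∞}
    (h : ∀ (z : Fin n → ℝ) (r : ℝ), 0 < r →
      ∫⁻ x in closedBall z r, cubeMax ((weightMeasure w).restrict (closedBall z r)) x ≤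
        K * weightMeasure w (closedBall z r)) : fujiiWilson w ≤ K := by
  refine iSup₂_le fun z r => iSup_le fun hr => ENNReal.div_le_of_le_mul ?_
  rw [axisCube_eq_closedBall z hr, lintegral_cube_maximalFn hw]
  exact h z _ (half_pos hr)

/-- On a cube of positive mass the localized maximal function dominates the average. The lower bound
lets additive dimensional constants be absorbed into multiples of `[w]_{A_∞}`. -/
theorem MemAInfty.one_le_fujiiWilson (hw : MemAInfty w) : 1 ≤ fujiiWilson w := by
  have := hw.1.isLocallyFiniteMeasure
  obtain ⟨z, r, hr, hpos⟩ := hw.1.exists_measure_cube_pos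
  have hfin : weightMeasure w (closedBall z r) ≠ ∞ := measure_closedBall_lt_top.ne
  have hm : MeasurableSet (closedBall z r) := isClosed_closedBall.measurableSet
  have h1 : weightMeasure w (closedBall z r) ≤
      fujiiWilson w * weightMeasure w (closedBall z r) := by
    refine le_trans ?_ (lintegral_cubeMax_le_fujiiWilson hw z hr)
    calc weightMeasure w (closedBall z r) = ∫⁻ _ in closedBall z r,
          weightMeasure w (closedBall z r) / volume (closedBall z r) := by
          rw [setLIntegral_const, ENNReal.div_mul_cancel (volume_cube_ne_zero z hr)
            (volume_cube_ne_top z r)]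
      _ ≤ _ := setLIntegral_mono' hm fun x hx => by
          have := le_cubeMax (ν := (weightMeasure w).restrict (closedBall z r)) hr hx
          rwa [Measure.restrict_apply hm, inter_self] at this
  nth_rw 1 [← one_mul (weightMeasure w (closedBall z r))] at h1
  rwa [ENNReal.mul_le_mul_iff_left hpos.ne' hfin] at h1

theorem doublingConst_le {D : ℝ≥0∞}
    (h : ∀ (z : Fin n → ℝ) (r : ℝ), 0 < r →
      weightMeasure w (closedBall z (2 * r)) ≤ D * weightMeasure w (closedBall z r)) :
    doublingConst w ≤ D := by
  refine sInf_le fun z r hr => ?_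
  rw [axisCube_eq_closedBall z hr, axisCube_eq_closedBall z (by positivity), mul_div_assoc]
  exact h z _ (half_pos hr)

theorem measure_two_mul_le_doublingConst (hw : IsWeight w) (hD : doublingConst w < ∞)
    (z : Fin n → ℝ) {r : ℝ} (hr : 0 < r) :
    weightMeasure w (closedBall z (2 * r)) ≤ doublingConst w * weightMeasure w (closedBall z r) := by
  have := hw.isLocallyFiniteMeasure
  rw [← ENNReal.div_le_iff_le_mul (Or.inr hD.ne) (Or.inl measure_closedBall_lt_top.ne)]
  refine le_sInf fun D hD' => ENNReal.div_le_of_le_mul ?_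
  have h := hD' z (2 * r) (by positivity)
  rw [axisCube_eq_closedBall z (by positivity), axisCube_eq_closedBall z (by positivity)] at h
  convert h using 3
  · ring
  · congr 1; ring

theorem tauberianConst_le {α : ℝ} {c : ℝ≥0∞}
    (h : ∀ E : Set (Fin n → ℝ), MeasurableSet E →
      weightMeasure w {x | ENNReal.ofReal α < cubeMax (volume.restrict E) x} ≤
        c * weightMeasure w E) : tauberianConst w α ≤ c := by
  refine iSup₂_le fun E hE => iSup₂_le fun _ _ => ENNReal.div_le_of_le_mul ?_
  simp only [maximalFn_indicator_one hE]
  exact h E hE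

theorem measure_le_tauberianConst_mul {α : ℝ} {E : Set (Fin n → ℝ)} (hE : MeasurableSet E)
    (h0 : 0 < weightMeasure w E) (ht : weightMeasure w E < ∞) :
    weightMeasure w {x | ENNReal.ofReal α < cubeMax (volume.restrict E) x} ≤
      tauberianConst w α * weightMeasure w E := by
  rw [← ENNReal.div_le_iff_le_mul (Or.inl h0.ne') (Or.inl ht.ne)]
  simp only [← maximalFn_indicator_one hE]
  exact le_iSup₂_of_le E hE (le_iSup₂_of_le h0 ht le_rfl)

theorem IsWeight.one_le_tauberianConst (hw : IsWeight w) {α : ℝ} (hα : α < 1) :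
    1 ≤ tauberianConst w α := by
  have := hw.isLocallyFiniteMeasure
  obtain ⟨z, r, hr, hpos⟩ := hw.exists_measure_cube_pos
  have hfin : weightMeasure w (closedBall z r) < ∞ := measure_closedBall_lt_top
  have hm : MeasurableSet (closedBall z r) := isClosed_closedBall.measurableSet
  have hsub : closedBall z r ⊆
      {x | ENNReal.ofReal α < cubeMax (volume.restrict (closedBall z r)) x} := by
    intro x hx
    have := le_cubeMax (ν := volume.restrict (closedBall z r)) hr hx
    rw [Measure.restrict_apply hm, inter_self, ENNReal.div_self (volume_cube_ne_zero z hr)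
      (volume_cube_ne_top z r)] at this
    exact (ENNReal.ofReal_lt_one.2 hα).trans_le this
  have h1 := (measure_mono hsub).trans (measure_le_tauberianConst_mul (α := α) hm hpos hfin)
  nth_rw 1 [← one_mul (weightMeasure w (closedBall z r))] at h1
  rwa [ENNReal.mul_le_mul_iff_left hpos.ne' hfin.ne] at h1

theorem MemAInfty.one_le_toReal (hw : MemAInfty w) : 1 ≤ (fujiiWilson w).toReal := by
  rw [← ENNReal.toReal_one]
  exact ENNReal.toReal_mono hw.2.ne hw.one_le_fujiiWilson

/-- For this `δ`, `log (2^n/δ) = (n + 2) log 2 + 2^(n+2) W ≤ (n + 2 + 2^(n+2)) W`; the factor `2`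
comes from `log 2 ≥ 1/2`. -/
theorem MemAInfty.exists_isHalving (hw : MemAInfty w) : ∃ δ : ℝ, 0 < δ ∧ δ ≤ 1 / 2 ∧
    IsHalving (weightMeasure w) δ ∧
      (2 * (n + 2 + 2 ^ (n + 2)) * (fujiiWilson w).toReal)⁻¹ ≤ decayExponent n δ := by
  have := hw.1.isLocallyFiniteMeasure
  set W := (fujiiWilson w).toReal with hW
  have hW1 : 1 ≤ W := hw.one_le_toReal
  have hWe : ENNReal.ofReal W = fujiiWilson w := ENNReal.ofReal_toReal hw.2.ne
  have hexp : Real.exp (-(2 ^ (n + 2) * W)) ≤ 1 := Real.exp_le_one_iff.2 (by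
    have : 0 ≤ 2 ^ (n + 2) * W := by positivity
    linarith)
  have hδ0 : 0 < Real.exp (-(2 ^ (n + 2) * W)) / 4 := by positivity
  have hδ1 : Real.exp (-(2 ^ (n + 2) * W)) / 4 ≤ 1 / 2 := by linarith
  refine ⟨_, hδ0, hδ1, isHalving_of_fujiiWilson (weightMeasure_absolutelyContinuous w)
    (one_pos.trans_le hW1) fun z r hr => ?_, ?_⟩
  · rw [hWe]; exact lintegral_cubeMax_le_fujiiWilson hw z hr
  · have hlog := (Real.log_pos one_lt_two).trans_le (log_two_le_log_div n hδ0 hδ1)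
    have hl2 : Real.log 2 ≤ 1 := by linarith [Real.log_two_lt_d9]
    have hl2' : 1 / 2 ≤ Real.log 2 := by linarith [Real.log_two_gt_d9]
    have hub : Real.log (2 ^ n / (Real.exp (-(2 ^ (n + 2) * W)) / 4)) ≤
        (n + 2 + 2 ^ (n + 2)) * W := by
      rw [Real.log_div (by positivity) (by positivity), Real.log_div (by positivity) (by norm_num),
        Real.log_pow, Real.log_exp, show (4 : ℝ) = 2 ^ 2 by norm_num, Real.log_pow]
      have h1 : (n : ℝ) * Real.log 2 ≤ n * W := by gcongr; linarith
      push_cast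
      nlinarith
    rw [decayExponent, inv_eq_one_div, div_le_div_iff₀ (by positivity) hlog]
    calc 1 * Real.log (2 ^ n / (Real.exp (-(2 ^ (n + 2) * W)) / 4))
        ≤ 1 / 2 * (2 * (n + 2 + 2 ^ (n + 2)) * W) := by linarith
      _ ≤ _ := by gcongr

theorem MemAInfty.doublingConst_lt_top (hw : MemAInfty w) : doublingConst w < ∞ := by
  have := hw.1.isLocallyFiniteMeasure
  obtain ⟨δ, hδ, -, h, -⟩ := hw.exists_isHalving
  obtain ⟨D, hD, hD'⟩ := h.exists_doubling hδ
  exact (doublingConst_le hD').trans_lt hD.lt_top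

/-- The range of `α` and the exponent in the direct estimate. -/
theorem three_mul_rpow_le_half {κ W θ c α : ℝ} (hκ : 0 < κ) (hW : 1 ≤ W) (hc : 8 * κ ≤ c)
    (hθ : (2 * κ * W)⁻¹ ≤ θ) (hα : 1 - Real.exp (-(c * W)) < α) (hα1 : α < 1) :
    3 * (1 - α) ^ (θ / 2) ≤ 1 / 2 := by
  have hW0 : 0 < W := one_pos.trans_le hW
  have hθ0 : 0 < θ := lt_of_lt_of_le (by positivity) hθ
  have h1 : (1 - α) ^ (θ / 2) ≤ Real.exp (-2) := by
    calc (1 - α) ^ (θ / 2) ≤ Real.exp (-(c * W)) ^ (θ / 2) := by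
          apply Real.rpow_le_rpow <;> linarith
      _ = Real.exp (-(c * W * (θ / 2))) := by rw [← Real.exp_mul]; congr 1; ring
      _ ≤ Real.exp (-2) := by
          apply Real.exp_le_exp.2
          -- The range of `α` is chosen so that `(1-α)^(θ/2) ≤ exp (-2)`, and `3 exp (-2) ≤ 1/2`.
          have h2 : 8 * κ * W * ((2 * κ * W)⁻¹ / 2) ≤ c * W * (θ / 2) := by
            have : 0 ≤ c := le_trans (by positivity) hc
            gcongr
          have h3 : 8 * κ * W * ((2 * κ * W)⁻¹ / 2) = 2 := by field_simp; norm_num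
          linarith
  have h2 : (6 : ℝ) ≤ Real.exp 2 := by
    have : Real.exp 2 = Real.exp 1 * Real.exp 1 := by rw [← Real.exp_add]; norm_num
    have h3 := Real.exp_one_gt_d9
    rw [this]
    nlinarith
  have h3 : Real.exp (-2) ≤ 1 / 6 := by
    rw [Real.exp_neg, inv_eq_one_div]
    exact one_div_le_one_div_of_le (by norm_num) h2
  linarith

theorem MemAInfty.tauberianConst_le (hn : 1 ≤ n) (hw : MemAInfty w) {α : ℝ}
    (hα : 1 - Real.exp (-(8 * n * (n + 2 + 2 ^ (n + 2)) * (fujiiWilson w).toReal)) < α)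
    (hα1 : α < 1) :
    tauberianConst w α ≤ 1 + ENNReal.ofReal (6 * (n + 4 ^ n)) * doublingConst w ^ 2 *
      ENNReal.ofReal
        ((1 - α) ^ (8 * n * (n + 2 + 2 ^ (n + 2)) * (fujiiWilson w).toReal)⁻¹) := by
  have := hw.1.isLocallyFiniteMeasure
  obtain ⟨δ, hδ, hδ1, h, hθ⟩ := hw.exists_isHalving
  set W := (fujiiWilson w).toReal with hW
  have hW1 : 1 ≤ W := hw.one_le_toReal
  have hn1 : (1 : ℝ) ≤ n := by exact_mod_cast hn
  set κ : ℝ := n + 2 + 2 ^ (n + 2) with hκ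
  have hκ0 : 0 < κ := by positivity
  have hsmall := three_mul_rpow_le_half (c := 8 * n * κ) hκ0 hW1 (by nlinarith) hθ hα hα1
  have hα0 : 0 ≤ α := by
    have : Real.exp (-(8 * n * κ * W)) ≤ 1 := Real.exp_le_one_iff.2 (by
      have : 0 ≤ 8 * n * κ * W := by positivity
      linarith)
    linarith
  refine (_root_.tauberianConst_le fun E hE => h.tauberian hn (weightMeasure_absolutelyContinuous w) hδ
    hδ1 (fun z r hr => measure_two_mul_le_doublingConst hw.1 hw.doublingConst_lt_top z hr) hα0 hα1
    hsmall hE).trans ?_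
  refine add_le_add le_rfl (mul_le_mul' le_rfl (ENNReal.ofReal_le_ofReal
    (Real.rpow_le_rpow_of_exponent_ge (by linarith) (by linarith) ?_)))
  calc (8 * n * κ * W)⁻¹ = (2 * κ * W)⁻¹ / (4 * n) := by field_simp; norm_num
    _ ≤ _ := by gcongr

theorem MemAInfty.tauberianConst_le_one {w : (Fin 1 → ℝ) → ℝ} (hw : MemAInfty w) {α : ℝ}
    (hα : 1 - Real.exp (-(88 * (fujiiWilson w).toReal)) < α) (hα1 : α < 1) :
    tauberianConst w α ≤ 1 + ENNReal.ofReal 12 *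
      ENNReal.ofReal ((1 - α) ^ (88 * (fujiiWilson w).toReal)⁻¹) := by
  have := hw.1.isLocallyFiniteMeasure
  obtain ⟨δ, hδ, hδ1, h, hθ⟩ := hw.exists_isHalving
  set W := (fujiiWilson w).toReal with hW
  have hW1 : 1 ≤ W := hw.one_le_toReal
  -- For `n = 1`, `n + 2 + 2^(n+2) = 11`, and the smallness condition asks for `c ≥ 8 * 11 = 88`.
  have hθ : (2 * 11 * W)⁻¹ ≤ decayExponent 1 δ := by convert hθ using 3; norm_num
  have hsmall := three_mul_rpow_le_half (c := 88) (κ := 11) (by norm_num) hW1 (by norm_num) hθ hα hα1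
  have hα0 : 0 ≤ α := by
    have : Real.exp (-(88 * W)) ≤ 1 := Real.exp_le_one_iff.2 (by linarith)
    linarith
  refine (_root_.tauberianConst_le fun E hE => h.tauberian_one (weightMeasure_absolutelyContinuous w)
    hδ hδ1 hα0 hα1 hsmall hE).trans ?_
  refine add_le_add le_rfl (mul_le_mul' le_rfl (ENNReal.ofReal_le_ofReal
    (Real.rpow_le_rpow_of_exponent_ge (by linarith) (by linarith) ?_)))
  calc (88 * W)⁻¹ ≤ (2 * 11 * W)⁻¹ / 2 := by
        rw [← one_div, ← one_div, div_div]
        exact one_div_le_one_div_of_le (by positivity) (by linarith)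
    _ ≤ _ := by gcongr

/-- A single `α` with Tauberian constant at most `3/2` already forces `A_∞`; this serves both the
quantitative converse and the limit statement. -/
theorem IsWeight.memAInfty_of_tauberianConst_le (hn : 1 ≤ n) (hw : IsWeight w) {α : ℝ}
    (hα0 : 0 < α) (hα1 : α < 1) (h : tauberianConst w α ≤ ENNReal.ofReal (3 / 2)) :
    MemAInfty w ∧ fujiiWilson w ≤
      ENNReal.ofReal (2 + 4 ^ (n + 1) / decayExponent n ((1 - α) / 2)) := by
  have := hw.isLocallyFiniteMeasure
  have hac := weightMeasure_absolutelyContinuous w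
  have hH : IsHalving (weightMeasure w) ((1 - α) / 2) :=
    isHalving_of_tauberian hn hac hα0 hα1 fun E hE h0 ht =>
      (measure_le_tauberianConst_mul hE h0 ht).trans (by gcongr)
  have hle := fujiiWilson_le hw fun z r hr =>
    hH.lintegral_cubeMax_le hac (by linarith) (by linarith) z hr
  exact ⟨⟨hw, hle.trans_lt ENNReal.ofReal_lt_top⟩, hle⟩

theorem IsWeight.fujiiWilson_le_of_tauberianConst_le (hn : 1 ≤ n) (hw : IsWeight w) {B β : ℝ}
    (hB : 1 ≤ B) (hβ : 1 ≤ β)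
    (h : ∀ α : ℝ, 1 - Real.exp (-β) < α → α < 1 →
      tauberianConst w α ≤ 1 + ENNReal.ofReal (B * (1 - α) ^ (1 / β))) :
    MemAInfty w ∧ fujiiWilson w ≤
      ENNReal.ofReal ((2 + 4 ^ (n + 1) * (2 * (n + 3))) * (β * (1 + Real.log B))) := by
  have hB0 : 0 < B := one_pos.trans_le hB
  have hβ0 : 0 < β := one_pos.trans_le hβ
  have hlB : 0 ≤ Real.log B := Real.log_nonneg hB
  have hl2 : Real.log 2 ≤ 1 := by linarith [Real.log_two_lt_d9]
  have hl2' : 1 / 2 ≤ Real.log 2 := by linarith [Real.log_two_gt_d9]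
  -- At `1 - α = exp (-g)` the error `B (1-α)^(1/β)` equals `exp (-1) / 2`. The summand `1` makes `g
  -- > β`, so this `α` lies in the permitted range.
  set g : ℝ := β * (1 + Real.log (2 * B)) with hg
  have hl2B : Real.log (2 * B) = Real.log 2 + Real.log B := Real.log_mul two_ne_zero hB0.ne'
  have hβg : β < g := by
    rw [hg, hl2B]
    nlinarith
  have hexp1 : Real.exp (-g) < 1 := by
    rw [← Real.exp_zero]; exact Real.exp_lt_exp.2 (by linarith)
  have hsmall : B * (1 - (1 - Real.exp (-g))) ^ (1 / β) ≤ 1 / 2 := by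
    have e : -g * (1 / β) = -1 + -Real.log (2 * B) := by rw [hg]; field_simp; ring
    rw [sub_sub_cancel, ← Real.exp_mul, e, Real.exp_add, Real.exp_neg (Real.log _),
      Real.exp_log (by positivity)]
    have : Real.exp (-1) ≤ 1 := Real.exp_le_one_iff.2 (by norm_num)
    calc B * (Real.exp (-1) * (2 * B)⁻¹) = Real.exp (-1) * (1 / 2) := by field_simp
      _ ≤ _ := by linarith
  have ht : tauberianConst w (1 - Real.exp (-g)) ≤ ENNReal.ofReal (3 / 2) := by
    refine (h _ ?_ ?_).trans ?_
    · have := Real.exp_lt_exp.2 (neg_lt_neg hβg)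
      linarith
    · have := Real.exp_pos (-g)
      linarith
    · rw [← ENNReal.ofReal_one, ← ENNReal.ofReal_add zero_le_one
        (mul_nonneg hB0.le (Real.rpow_nonneg (by rw [sub_sub_cancel]; positivity) _))]
      exact ENNReal.ofReal_le_ofReal (by linarith)
  obtain ⟨hA, hle⟩ := hw.memAInfty_of_tauberianConst_le hn (by linarith)
    (by have := Real.exp_pos (-g); linarith) ht
  refine ⟨hA, hle.trans (ENNReal.ofReal_le_ofReal ?_)⟩
  rw [sub_sub_cancel, decayExponent, div_div_eq_mul_div, Real.log_div (by positivity) (by positivity),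
    Real.log_div (by positivity) two_ne_zero, Real.log_pow, Real.log_exp]
  set m : ℝ := β * (1 + Real.log B) with hm
  have hm1 : 1 ≤ m := by rw [hm]; nlinarith
  have hgm : g ≤ 2 * m := by rw [hg, hm, hl2B]; nlinarith
  have hnum : (n : ℝ) * Real.log 2 - (-g - Real.log 2) ≤ (n + 3) * m := by
    have : (n : ℝ) * Real.log 2 ≤ n * m := by gcongr; linarith
    linarith
  have hdiv : 4 ^ (n + 1) * ((n : ℝ) * Real.log 2 - (-g - Real.log 2)) / Real.log 2 ≤
      4 ^ (n + 1) * (2 * (n + 3)) * m := by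
    rw [div_le_iff₀ (by linarith)]
    calc 4 ^ (n + 1) * ((n : ℝ) * Real.log 2 - (-g - Real.log 2))
        ≤ 4 ^ (n + 1) * ((n + 3) * m) := by gcongr
      _ = 4 ^ (n + 1) * (2 * (n + 3)) * m * (1 / 2) := by ring
      _ ≤ _ := by gcongr
  linarith

theorem MemAInfty.tendsto_tauberianConst (hn : 1 ≤ n) (hw : MemAInfty w) :
    Tendsto (tauberianConst w) (𝓝[<] 1) (𝓝 1) := by
  have hW1 : 1 ≤ (fujiiWilson w).toReal := hw.one_le_toReal
  set e : ℝ := 8 * n * (n + 2 + 2 ^ (n + 2)) * (fujiiWilson w).toReal with he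
  have he0 : 0 < e := by positivity
  have hmem : ∀ᶠ α in 𝓝[<] (1 : ℝ), 1 - Real.exp (-e) < α ∧ α < 1 :=
    Ioo_mem_nhdsLT (by have := Real.exp_pos (-e); linarith)
  have hlim : Tendsto (fun α : ℝ => 1 + ENNReal.ofReal (6 * (n + 4 ^ n)) * doublingConst w ^ 2 *
      ENNReal.ofReal ((1 - α) ^ e⁻¹)) (𝓝[<] 1) (𝓝 1) := by
    have h1 : Tendsto (fun α : ℝ => ENNReal.ofReal ((1 - α) ^ e⁻¹)) (𝓝[<] 1) (𝓝 0) := by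
      have hc : ContinuousAt (fun α : ℝ => (1 - α) ^ e⁻¹) 1 :=
        ContinuousAt.rpow_const (by fun_prop) (Or.inr (inv_nonneg.2 he0.le))
      have h2 := (ENNReal.continuous_ofReal.continuousAt.comp hc).tendsto
      simp only [Function.comp_def, sub_self, Real.zero_rpow (inv_ne_zero he0.ne'),
        ENNReal.ofReal_zero] at h2
      exact h2.mono_left nhdsWithin_le_nhds
    have h2 := (ENNReal.Tendsto.const_mul (a := ENNReal.ofReal (6 * (n + 4 ^ n)) *
      doublingConst w ^ 2) h1 (Or.inr (ENNReal.mul_ne_top ENNReal.ofReal_ne_top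
        (ENNReal.pow_ne_top hw.doublingConst_lt_top.ne)))).const_add 1
    simpa using h2
  refine tendsto_of_tendsto_of_tendsto_of_le_of_le' tendsto_const_nhds hlim ?_ ?_
  · filter_upwards [hmem] with α hα using hw.1.one_le_tauberianConst hα.2
  · filter_upwards [hmem] with α hα using hw.tauberianConst_le hn hα.1 hα.2

theorem IsWeight.memAInfty_of_tendsto (hn : 1 ≤ n) (hw : IsWeight w)
    (h : Tendsto (tauberianConst w) (𝓝[<] 1) (𝓝 1)) : MemAInfty w := by
  have h1 : ∀ᶠ α in 𝓝[<] (1 : ℝ), tauberianConst w α < ENNReal.ofReal (3 / 2) :=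
    h.eventually (gt_mem_nhds (by rw [← ENNReal.ofReal_one]; exact
      (ENNReal.ofReal_lt_ofReal_iff (by norm_num)).2 (by norm_num)))
  obtain ⟨α, hα, hα01⟩ := (h1.and (Ioo_mem_nhdsLT (zero_lt_one (α := ℝ)))).exists
  exact (hw.memAInfty_of_tauberianConst_le hn hα01.1 hα01.2 hα.le).1

end Weights

end

/-! ### The theorem. -/

/-- The bounds on `C^w(α) - 1` are written additively because the constants take values in `[0, ∞]`.
Taking `toReal` of the Fujii–Wilson constant loses nothing, as it is finite for `w ∈ A_∞`. -/
theorem theorem1p2 :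
    -- direct part, in every dimension; the doubling constant is finite
    (∀ n : ℕ, 1 ≤ n → ∃ C c : ℝ, 1 < C ∧ 1 < c ∧
      ∀ w : (Fin n → ℝ) → ℝ, MemAInfty w →
        doublingConst w < ∞ ∧
        ∀ α : ℝ, 1 - Real.exp (-(c * (fujiiWilson w).toReal)) < α → α < 1 →
          tauberianConst w α ≤ 1 + ENNReal.ofReal C * doublingConst w ^ 2 *
            ENNReal.ofReal ((1 - α) ^ (c * (fujiiWilson w).toReal)⁻¹)) ∧
    -- direct part in dimension one, without the doubling constant
    (∃ C c : ℝ, 1 < C ∧ 1 < c ∧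
      ∀ w : (Fin 1 → ℝ) → ℝ, MemAInfty w →
        ∀ α : ℝ, 1 - Real.exp (-(c * (fujiiWilson w).toReal)) < α → α < 1 →
          tauberianConst w α ≤ 1 + ENNReal.ofReal C *
            ENNReal.ofReal ((1 - α) ^ (c * (fujiiWilson w).toReal)⁻¹)) ∧
    -- converse part
    (∀ n : ℕ, 1 ≤ n → ∃ K : ℝ, 0 < K ∧
      ∀ w : (Fin n → ℝ) → ℝ, IsWeight w →
        ∀ B β : ℝ, 1 ≤ B → 1 ≤ β →
          (∀ α : ℝ, 1 - Real.exp (-β) < α → α < 1 →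
            tauberianConst w α ≤ 1 + ENNReal.ofReal (B * (1 - α) ^ (1 / β))) →
          MemAInfty w ∧ fujiiWilson w ≤ ENNReal.ofReal (K * (β * (1 + Real.log B)))) ∧
    -- characterization of `A_∞` by the weighted Solyanik estimate
    (∀ n : ℕ, 1 ≤ n → ∀ w : (Fin n → ℝ) → ℝ, IsWeight w →
      (Tendsto (tauberianConst w) (𝓝[<] 1) (𝓝 1) ↔ MemAInfty w)) := by
  refine ⟨fun n hn => ?_, ⟨12, 88, by norm_num, by norm_num, fun w hw α hα hα1 =>
    hw.tauberianConst_le_one hα hα1⟩, fun n hn => ?_, fun n hn w hw =>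
    ⟨hw.memAInfty_of_tendsto hn, fun h => h.tendsto_tauberianConst hn⟩⟩
  · have hn1 : (1 : ℝ) ≤ n := by exact_mod_cast hn
    have h4 : (1 : ℝ) ≤ 4 ^ n := one_le_pow₀ (by norm_num)
    have h2 : (1 : ℝ) ≤ 2 ^ (n + 2) := one_le_pow₀ (by norm_num)
    refine ⟨6 * (n + 4 ^ n), 8 * n * (n + 2 + 2 ^ (n + 2)), by linarith, by nlinarith,
      fun w hw => ⟨hw.doublingConst_lt_top, fun α hα hα1 => hw.tauberianConst_le hn hα hα1⟩⟩
  · exact ⟨2 + 4 ^ (n + 1) * (2 * (n + 3)), by positivity, fun w hw B β hB hβ h =>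
      hw.fujiiWilson_le_of_tauberianConst_le hn hB hβ h⟩
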